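/- Let $M$ be a smooth manifold of dimension $2n+1$, $n\ge 1$, with a contact sub-Riemannian structure $(\Delta,g)$: $\Delta\subset TM$ is a smooth distribution of rank $2n$ which is locally the kernel of a smooth 1-form $\omega$ with $\omega\wedge(d\omega)^n$ nowhere zero, and $g$ is a smooth inner product on $\Delta$. Let $$H(p,q)=\frac12\sup_{v\in\Delta_q\setminus\{0\}}\frac{\langle p,v\rangle^2}{g_q(v,v)},\qquad q\in M,\ p\in T_q^*M,$$ be the sub-Riemannian Hamiltonian, $\vec H$ its Hamiltonian vector field on $T^*M$ and $\pi:T^*M\to M$ the projection. For $q_0\in M$ let $\mathcal E_{q_0}(t,p)=\pi\circ e^{t\vec H}(p,q_0)$ be the sub-Riemannian exponential, defined for those $t\ge 0$ and $p\in T_{q_0}^*M$ for which the integral curve of $\vec H$ issued from $(p,q_0)$ exists on $[0,t]$. A conjugate time for $p$ is a time $t>0$ such that $\mathcal E_{q_0}(t,\cdot)$ is defined at $p$ and critical at $p$ (its differential at $p$ is not onto); $t_c(p)\in[0,+\infty]$ denotes the first conjugate time, that is, the infimum of the conjugate times for $p$. Fix $q_0\in M$ and a vector $X_0\in T_{q_0}M\setminus\Delta_{q_0}$,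 and set $h_0(p)=\langle p,X_0\rangle$ for $p\in T^*_{q_0}M$. Then: (a) for every $\bar h_0>0$ there is $\varepsilon>0$ such that every $p\in T^*_{q_0}M$ with $H(p,q_0)=\frac12$ and $t_c(p)<\varepsilon$ satisfies $|h_0(p)|>\bar h_0$; (b) for every $\alpha>0$ there is $R>0$ such that every critical point $p$ of $\mathcal E_{q_0}(1,\cdot)$ with $0<H(p,q_0)<R$ satisfies $h_0(p)^2>\alpha\,H(p,q_0)$. -/

import Mathlib

open Set Topology
open scoped Manifold ContDiff

/-- The model space `ℝ^(2n+1)` of a contact manifold of dimension `2n+1`. -/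
abbrev ContactModel (n : ℕ) : Type := EuclideanSpace ℝ (Fin (2 * n + 1))

section Covectors

variable {n : ℕ} {M : Type*} [TopologicalSpace M] [ChartedSpace (ContactModel n) M]

/-- The cotangent space `T*_q M`. -/
abbrev CotSpace (n : ℕ) {M : Type*} [TopologicalSpace M] [ChartedSpace (ContactModel n) M]
    (q : M) : Type :=
  TangentSpace (𝓡 (2 * n + 1)) q →L[ℝ] ℝ

/-- The cotangent bundle `T*M`, as the set of pairs (point, covector at this point). -/
abbrev CotBundle (n : ℕ) (M : Type*) [TopologicalSpace M] [ChartedSpace (ContactModel n) M] :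
    Type _ :=
  Bundle.TotalSpace (ContactModel n →L[ℝ] ℝ) (fun q : M => CotSpace n q)

/-- The momentum coordinates of a covector `p ∈ T*_q M` in the chart `φ` of `M` around `c`:
the covector `p ∘ D(φ⁻¹)(φ q)` on `ℝ^(2n+1)`. -/
noncomputable def covectorInChart (c q : M) (p : CotSpace n q) : ContactModel n →L[ℝ] ℝ :=
  let φ := extChartAt (𝓡 (2 * n + 1)) c
  ContinuousLinearMap.comp (show ContactModel n →L[ℝ] ℝ from p)
    (mfderiv 𝓘(ℝ, ContactModel n) (𝓡 (2 * n + 1)) φ.symm (φ q))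

/-- The covector at the point `φ⁻¹ x` whose momentum coordinates in the chart `φ` around `c`
are `ξ`: the covector `ξ ∘ Dφ(φ⁻¹ x)`. -/
noncomputable def covectorOfChart (c : M) (x : ContactModel n) (ξ : ContactModel n →L[ℝ] ℝ) :
    CotSpace n ((extChartAt (𝓡 (2 * n + 1)) c).symm x) :=
  let φ := extChartAt (𝓡 (2 * n + 1)) c
  ContinuousLinearMap.comp ξ
    (mfderiv (𝓡 (2 * n + 1)) 𝓘(ℝ, ContactModel n) φ (φ.symm x))

/-- The expression `x ↦ θ(φ⁻¹ x) ∘ D(φ⁻¹)(x)` of a 1-form `θ` in the chart `φ` around `c`. -/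
noncomputable def oneFormInChart (θ : ∀ q : M, CotSpace n q) (c : M) (x : ContactModel n) :
    ContactModel n →L[ℝ] ℝ :=
  let φ := extChartAt (𝓡 (2 * n + 1)) c
  ContinuousLinearMap.comp (show ContactModel n →L[ℝ] ℝ from θ (φ.symm x))
    (mfderiv 𝓘(ℝ, ContactModel n) (𝓡 (2 * n + 1)) φ.symm x)

/-- The 1-form `θ` is smooth on the set `U`: it is so in charts. -/
def SmoothOneFormOn (θ : ∀ q : M, CotSpace n q) (U : Set M) : Prop :=
  ∀ c : M, ContDiffOn ℝ ∞ (oneFormInChart θ c)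
    ((extChartAt (𝓡 (2 * n + 1)) c).target ∩ (extChartAt (𝓡 (2 * n + 1)) c).symm ⁻¹' U)

end Covectors

/-- The exterior derivative `dα(u, v) = (D_u α)(v) - (D_v α)(u)` at `x` of a 1-form `α` on
a normed space. -/
noncomputable def dOneForm {E : Type*} [NormedAddCommGroup E] [NormedSpace ℝ E]
    (α : E → E →L[ℝ] ℝ) (x u v : E) : ℝ :=
  fderiv ℝ α x u v - fderiv ℝ α x v u

/-- The value of the alternating form `a ∧ b^n` on `2n+1` vectors, up to a positive factor which
depends only on `n`, for a linear form `a` and an alternating bilinear form `b`. -/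
noncomputable def wedgePow {E : Type*} (n : ℕ) (a : E → ℝ) (b : E → E → ℝ)
    (v : Fin (2 * n + 1) → E) : ℝ :=
  ∑ σ : Equiv.Perm (Fin (2 * n + 1)), ((Equiv.Perm.sign σ : ℤ) : ℝ) *
    (a (v (σ 0)) *
      ∏ i : Fin n, b (v (σ ⟨2 * (i : ℕ) + 1, by omega⟩)) (v (σ ⟨2 * (i : ℕ) + 2, by omega⟩)))

/-- `θ ∧ (dθ)^n` is nonzero at the point `q`. -/
def IsContactFormAt {n : ℕ} {M : Type*} [TopologicalSpace M] [ChartedSpace (ContactModel n) M]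
    (θ : ∀ q : M, CotSpace n q) (q : M) : Prop :=
  let x : ContactModel n := extChartAt (𝓡 (2 * n + 1)) q q
  let α : ContactModel n → ContactModel n →L[ℝ] ℝ := oneFormInChart θ q
  ∃ v : Fin (2 * n + 1) → ContactModel n, wedgePow n (α x) (dOneForm α x) v ≠ 0

/-- A contact sub-Riemannian structure `(Δ, g)` on a manifold `M` of dimension `2n+1`: a smooth
distribution `Δ` of rank `2n` with a smoothly varying inner product `g` on it, such that `Δ` is
locally the kernel of a smooth 1-form `θ` with `θ ∧ (dθ)^n` nowhere zero. -/
structure ContactSubRiemannian (n : ℕ) (M : Type*) [TopologicalSpace M]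
    [ChartedSpace (ContactModel n) M] [IsManifold (𝓡 (2 * n + 1)) ∞ M] where
  /-- the distribution -/
  Δ : ∀ q : M, Submodule ℝ (TangentSpace (𝓡 (2 * n + 1)) q)
  /-- the metric on the distribution -/
  g : ∀ q : M, LinearMap.BilinForm ℝ (Δ q)
  g_symm : ∀ (q : M) (v w : Δ q), g q v w = g q w v
  g_pos : ∀ (q : M) (v : Δ q), v ≠ 0 → 0 < g q v v
  /-- `Δ` and `g` are smooth: near every point there is a smooth frame of `Δ` in which the
  coefficients of `g` are smooth functions. -/
  smooth : ∀ q₀ : M, ∃ U : Set M, IsOpen U ∧ q₀ ∈ U ∧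
    ∃ Y : Fin (2 * n) → ∀ q : M, Δ q,
      (∀ i, ContMDiffOn (𝓡 (2 * n + 1)) (𝓡 (2 * n + 1)).tangent ∞
        (fun q : M => (⟨q, (Y i q : TangentSpace (𝓡 (2 * n + 1)) q)⟩ :
          TangentBundle (𝓡 (2 * n + 1)) M)) U) ∧
      (∀ q ∈ U, LinearIndependent ℝ (fun i => Y i q) ∧
        Submodule.span ℝ (range fun i => Y i q) = ⊤) ∧
      (∀ i j, ContMDiffOn (𝓡 (2 * n + 1)) 𝓘(ℝ, ℝ) ∞ (fun q : M => g q (Y i q) (Y j q)) U)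
  /-- `Δ` is a contact distribution. -/
  contact : ∀ q₀ : M, ∃ U : Set M, IsOpen U ∧ q₀ ∈ U ∧
    ∃ θ : ∀ q : M, CotSpace n q, SmoothOneFormOn θ U ∧
      ∀ q ∈ U, (∀ v, v ∈ Δ q ↔ θ q v = 0) ∧ IsContactFormAt θ q

namespace ContactSubRiemannian

variable {n : ℕ} {M : Type*} [TopologicalSpace M] [ChartedSpace (ContactModel n) M]
  [IsManifold (𝓡 (2 * n + 1)) ∞ M]

/-- The sub-Riemannian Hamiltonian
`H(p, q) = 1/2 * sup_{v ∈ Δ_q, v ≠ 0} ⟨p, v⟩² / g_q(v, v)`. -/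
noncomputable def hamiltonian (S : ContactSubRiemannian n M) (q : M) (p : CotSpace n q) : ℝ :=
  1 / 2 * ⨆ v : {v : S.Δ q // v ≠ 0}, p (v : S.Δ q) ^ 2 / S.g q v v

/-- The Hamiltonian in the canonical coordinates `(x, ξ)` of `T*M` given by the chart of `M`
around `c`. -/
noncomputable def hamiltonianInChart (S : ContactSubRiemannian n M) (c : M)
    (x : ContactModel n) (ξ : ContactModel n →L[ℝ] ℝ) : ℝ :=
  S.hamiltonian ((extChartAt (𝓡 (2 * n + 1)) c).symm x) (covectorOfChart c x ξ)

/-- The curve `z` in `T*M` is a normal extremal on `[0, T]`, that is, an integral curve of the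
Hamiltonian vector field of `H`: its projection to `M` is continuous, and Hamilton's equations
`x' = ∂H/∂ξ`, `ξ' = -∂H/∂x` hold in the canonical coordinates `(x, ξ)` of every chart, at each
time at which the curve is in the domain of this chart. (The first equation is tested on all
linear forms `a` and the second one on all vectors `u`.) -/
def IsNormalExtremal (S : ContactSubRiemannian n M) (T : ℝ) (z : ℝ → CotBundle n M) : Prop :=
  ContinuousOn (fun t => (z t).proj) (Icc 0 T) ∧
  ∀ c : M, ∀ t ∈ Icc 0 T, (z t).proj ∈ (extChartAt (𝓡 (2 * n + 1)) c).source →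
    let x : ℝ → ContactModel n := fun s => extChartAt (𝓡 (2 * n + 1)) c (z s).proj
    let ξ : ℝ → ContactModel n →L[ℝ] ℝ := fun s => covectorInChart c (z s).proj (z s).snd
    (∀ a : ContactModel n →L[ℝ] ℝ, HasDerivWithinAt (fun s => a (x s))
      (fderiv ℝ (fun η => S.hamiltonianInChart c (x t) η) (ξ t) a) (Icc 0 T) t) ∧
    (∀ u : ContactModel n, HasDerivWithinAt (fun s => ξ s u)
      (-(fderiv ℝ (fun y => S.hamiltonianInChart c y (ξ t)) (x t) u)) (Icc 0 T) t)

/-- The covectors `p` at `q` such that the normal extremal issued from `(q, p)` exists on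
`[0, t]`: the domain of the sub-Riemannian exponential at `q` at time `t`. -/
def expDomain (S : ContactSubRiemannian n M) (q : M) (t : ℝ) : Set (CotSpace n q) :=
  {p | ∃ z : ℝ → CotBundle n M, z 0 = ⟨q, p⟩ ∧ S.IsNormalExtremal t z}

open Classical in
/-- The sub-Riemannian exponential `𝓔_q(t, p)`: the projection to `M` of the point reached at
time `t` by the normal extremal issued from `(q, p)`. Outside its domain its value is
irrelevant (we take `q`). -/
noncomputable def exp (S : ContactSubRiemannian n M) (q : M) (t : ℝ) (p : CotSpace n q) : M :=
  if h : p ∈ S.expDomain q t then (h.choose t).proj else q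

/-- `p` is a critical (singular) point of the exponential at time `t`, i.e. of the map
`𝓔_q(t, ·)` from (its domain in) `T*_q M` to `M`: its differential at `p` is not onto. -/
def IsCriticalPoint (S : ContactSubRiemannian n M) (q : M) (t : ℝ) (p : CotSpace n q) : Prop :=
  p ∈ S.expDomain q t ∧
    ¬ Function.Surjective (mfderiv 𝓘(ℝ, ContactModel n →L[ℝ] ℝ) (𝓡 (2 * n + 1))
      (fun p' : ContactModel n →L[ℝ] ℝ => S.exp q t p') p)

/-- `t` is a conjugate time for `p`. -/
def IsConjugateTime (S : ContactSubRiemannian n M) (q : M) (p : CotSpace n q) (t : ℝ) : Prop :=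
  0 < t ∧ S.IsCriticalPoint q t p

/-- The first conjugate time `t_c(p)` of `p` (`+∞` if `p` has no conjugate time). -/
noncomputable def firstConjugateTime (S : ContactSubRiemannian n M) (q : M) (p : CotSpace n q) :
    EReal :=
  sInf ((fun t : ℝ => (t : EReal)) '' {t | S.IsConjugateTime q p t})

end ContactSubRiemannian

/- In a chart, `H(x, ξ) = ξ(B_x ξ) / 2`, where the cometric `B_x` is nonnegative and its kernel is
spanned by a contact form. If `E(t, ·)` is critical at `ξ`, there is a nonzero Jacobi field `(x, η)`
along the extremal of `ξ` with `x(0) = 0` and `x(t) = 0`. The pairing `η(x)` then vanishes at both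
ends, so that its derivative has integral `0`; as `B` is nonnegative this forces `x = 0` on `[0, t]`
when `t` is small. Hence `η` stays in the kernel of the cometric, that is, it is a multiple of the
contact form, and the contact condition makes it vanish unless `B ξ = 0`. All bounds are locally
uniform in `ξ`, so there is no small conjugate time on the compact set `H = 1/2`, `|h₀| ≤ b`. Both
assertions follow from `E(t, c p) = E(c t, p)`. -/

set_option maxSynthPendingDepth 3

section Flow

variable {V : Type*} [NormedAddCommGroup V] [NormedSpace ℝ V]

theorem exists_local_flow_lipschitzOnWith [CompleteSpace V] {G : V → V} {w₀ : V}
    (hG : ContDiffAt ℝ 1 G w₀) {U : Set V} (hU : U ∈ 𝓝 w₀) :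
    ∃ r > 0, ∃ ε > 0, ∃ L : NNReal, ∃ α : V → ℝ → V,
      (∀ w ∈ Metric.ball w₀ r, α w 0 = w ∧
        ∀ t ∈ Ioo (-ε) ε, α w t ∈ U ∧ HasDerivAt (α w) (G (α w t)) t) ∧
      ∀ t ∈ Ioo (-ε) ε, LipschitzOnWith L (α · t) (Metric.ball w₀ r) := by
  obtain ⟨ε, hε, a, r, _, _, hr, hPL⟩ := IsPicardLindelof.of_contDiffAt_one hG
  obtain ⟨α, hα, L, hL⟩ :=
    (hPL 0).exists_forall_mem_closedBall_eq_hasDerivWithinAt_lipschitzOnWith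
  simp only [zero_sub, zero_add] at hα hL
  have hr₀ : (0 : ℝ) < r := NNReal.coe_pos.2 hr
  have hcont : ContinuousAt (Function.uncurry α) (w₀, 0) :=
    (continuousOn_prod_of_continuousOn_lipschitzOnWith _ L
      (fun w hw => HasDerivWithinAt.continuousOn (hα w hw).2) hL).continuousAt
      (prod_mem_nhds (Metric.closedBall_mem_nhds _ hr₀) (Icc_mem_nhds (neg_lt_zero.2 hε) hε))
  have hmem : ∀ᶠ p : V × ℝ in 𝓝 (w₀, 0), α p.1 p.2 ∈ U :=
    hcont.eventually_mem <| by
      rwa [Function.uncurry_apply_pair, (hα w₀ (Metric.mem_closedBall_self r.2)).1]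
  obtain ⟨δ, hδ, hδU⟩ := Metric.eventually_nhds_iff_ball.1 hmem
  have hball : Metric.ball w₀ (min δ r) ⊆ Metric.closedBall w₀ r :=
    (Metric.ball_subset_ball (min_le_right _ _)).trans Metric.ball_subset_closedBall
  have hIcc : Ioo (-min δ ε) (min δ ε) ⊆ Ioo (-ε) ε :=
    Ioo_subset_Ioo (neg_le_neg (min_le_right _ _)) (min_le_right _ _)
  refine ⟨min δ r, lt_min hδ hr₀, min δ ε, lt_min hδ hε, L, α,
    fun w hw => ⟨(hα w (hball hw)).1, fun t ht => ⟨hδU (w, t) ?_, ?_⟩⟩,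
    fun t ht => (hL t (Ioo_subset_Icc_self (hIcc ht))).mono hball⟩
  · rw [← ball_prod_same]
    refine ⟨Metric.ball_subset_ball (min_le_left _ _) hw, ?_⟩
    simpa using abs_lt.2 ⟨(neg_le_neg (min_le_left _ _)).trans_lt ht.1,
      ht.2.trans_le (min_le_left _ _)⟩
  · exact ((hα w (hball hw)).2 t (Ioo_subset_Icc_self (hIcc ht))).hasDerivAt
      (Icc_mem_nhds (hIcc ht).1 (hIcc ht).2)

theorem norm_sub_sub_fderiv_le_of_lipschitzOnWith {W : Type*} [NormedAddCommGroup W]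
    [NormedSpace ℝ W] {F : V → W} {s : Set V} {C : NNReal} (hs : Convex ℝ s)
    (hd : ∀ z ∈ s, DifferentiableAt ℝ F z) (hC : LipschitzOnWith C (fderiv ℝ F) s) {a b : V}
    (ha : a ∈ s) (hb : b ∈ s) :
    ‖F b - F a - fderiv ℝ F a (b - a)‖ ≤ C * ‖b - a‖ ^ 2 := by
  have hseg : segment ℝ a b ⊆ s := hs.segment_subset ha hb
  have hderiv : ∀ x ∈ segment ℝ a b, ‖fderiv ℝ F x - fderiv ℝ F a‖ ≤ C * ‖b - a‖ := fun x hx =>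
    (hC.norm_sub_le (hseg hx) ha).trans <| by
      gcongr
      exact norm_sub_le_of_mem_segment hx
  calc ‖F b - F a - fderiv ℝ F a (b - a)‖ ≤ C * ‖b - a‖ * ‖b - a‖ :=
        (convex_segment a b).norm_image_sub_le_of_norm_hasFDerivWithin_le'
          (fun x hx => (hd x (hseg hx)).hasFDerivAt.hasFDerivWithinAt) hderiv
          (left_mem_segment ℝ a b) (right_mem_segment ℝ a b)
    _ = C * ‖b - a‖ ^ 2 := by ring

theorem hasFDerivAt_of_norm_sub_sub_le_sq {W : Type*} [NormedAddCommGroup W] [NormedSpace ℝ W]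
    {f : V → W} {L : V →L[ℝ] W} {x : V} {C : ℝ}
    (h : ∀ᶠ y in 𝓝 x, ‖f y - f x - L (y - x)‖ ≤ C * ‖y - x‖ ^ 2) : HasFDerivAt f L x := by
  refine .of_isLittleO (Asymptotics.IsBigO.trans_isLittleO (g := fun y => ‖y - x‖ ^ 2)
    (.of_bound C ?_) (Asymptotics.isLittleO_pow_sub_sub x one_lt_two))
  simpa using h

theorem gronwallBound_zero_left (K ε t : ℝ) :
    gronwallBound 0 K ε t = ε * gronwallBound 0 K 1 t := by
  unfold gronwallBound
  split_ifs <;> ring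

theorem norm_sub_sub_le_gronwallBound_of_variational {F : V → V} {s : Set V} {C : NNReal}
    {K d T : ℝ} (hs : Convex ℝ s) (hd : ∀ z ∈ s, DifferentiableAt ℝ F z)
    (hC : LipschitzOnWith C (fderiv ℝ F) s) (hK : ∀ z ∈ s, ‖fderiv ℝ F z‖ ≤ K)
    {z z' y : ℝ → V} (hzs : ∀ t ∈ Icc 0 T, z t ∈ s) (hzs' : ∀ t ∈ Icc 0 T, z' t ∈ s)
    (hz : ∀ t ∈ Icc 0 T, HasDerivAt z (F (z t)) t)
    (hz' : ∀ t ∈ Icc 0 T, HasDerivAt z' (F (z' t)) t)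
    (hy : ∀ t ∈ Icc 0 T, HasDerivAt y (fderiv ℝ F (z t) (y t)) t) (h0 : z' 0 - z 0 = y 0)
    (hdist : ∀ t ∈ Icc 0 T, ‖z' t - z t‖ ≤ d) {t : ℝ} (ht : t ∈ Icc 0 T) :
    ‖z' t - z t - y t‖ ≤ gronwallBound 0 K (C * d ^ 2) t := by
  have hw : ∀ t ∈ Icc 0 T, HasDerivAt (fun t => z' t - z t - y t)
      (F (z' t) - F (z t) - fderiv ℝ F (z t) (y t)) t :=
    fun t ht => ((hz' t ht).sub (hz t ht)).sub (hy t ht)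
  have hbound : ∀ t ∈ Icc 0 T, ‖F (z' t) - F (z t) - fderiv ℝ F (z t) (y t)‖ ≤
      K * ‖z' t - z t - y t‖ + C * d ^ 2 := fun t ht => by
    have hquad : ‖F (z' t) - F (z t) - fderiv ℝ F (z t) (z' t - z t)‖ ≤ C * d ^ 2 :=
      (norm_sub_sub_fderiv_le_of_lipschitzOnWith hs hd hC (hzs t ht) (hzs' t ht)).trans <| by
        gcongr
        exact hdist t ht
    calc ‖F (z' t) - F (z t) - fderiv ℝ F (z t) (y t)‖
        = ‖fderiv ℝ F (z t) (z' t - z t - y t) +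
            (F (z' t) - F (z t) - fderiv ℝ F (z t) (z' t - z t))‖ := by
          rw [map_sub _ (z' t - z t) (y t)]
          congr 1
          abel
      _ ≤ K * ‖z' t - z t - y t‖ + C * d ^ 2 :=
          norm_add_le_of_le (ContinuousLinearMap.le_of_opNorm_le _ (hK _ (hzs t ht)) _) hquad
  simpa using norm_le_gronwallBound_of_norm_deriv_right_le
    (fun t ht => (hw t ht).continuousAt.continuousWithinAt)
    (fun t ht => (hw t (Ico_subset_Icc_self ht)).hasDerivWithinAt) (by simp [h0])
    (fun t ht => hbound t (Ico_subset_Icc_self ht)) t ht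

/-- The vector field of the variational equation: `w = (z, A)` solves `z' = F z`,
`A' = DF(z) ∘ A`. -/
noncomputable def variationalField (F : V → V) (w : V × (V →L[ℝ] V)) : V × (V →L[ℝ] V) :=
  (F w.1, (fderiv ℝ F w.1).comp w.2)

theorem contDiffAt_variationalField {F : V → V} {w : V × (V →L[ℝ] V)}
    (hF : ContDiffAt ℝ 2 F w.1) : ContDiffAt ℝ 1 (variationalField F) w :=
  ((hF.of_le one_le_two).comp w contDiffAt_fst).prodMk
    (((hF.fderiv_right (m := 1) (by norm_num)).comp w contDiffAt_fst).clm_comp contDiffAt_snd)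

theorem exists_ball_lipschitzOnWith_fderiv {F : V → V} {z₀ : V} (hF : ContDiffAt ℝ 2 F z₀) :
    ∃ ρ > 0, ∃ C : NNReal, ∃ K : ℝ, LipschitzOnWith C (fderiv ℝ F) (Metric.ball z₀ ρ) ∧
      ∀ z ∈ Metric.ball z₀ ρ, DifferentiableAt ℝ F z ∧ ‖fderiv ℝ F z‖ ≤ K := by
  have hF' : ContDiffAt ℝ 1 (fderiv ℝ F) z₀ := hF.fderiv_right (by norm_num)
  obtain ⟨C, s, hs, hC⟩ := hF'.exists_lipschitzOnWith
  have hdiff : ∀ᶠ z in 𝓝 z₀, DifferentiableAt ℝ F z :=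
    (hF.eventually (by simp)).mono fun z hz => hz.differentiableAt two_ne_zero
  have hbound : ∀ᶠ z in 𝓝 z₀, ‖fderiv ℝ F z‖ < ‖fderiv ℝ F z₀‖ + 1 :=
    hF'.continuousAt.norm.eventually_lt continuousAt_const (lt_add_one _)
  obtain ⟨ρ, hρ, hball⟩ := Metric.eventually_nhds_iff_ball.1 ((hdiff.and hbound).and hs)
  exact ⟨ρ, hρ, C, _, hC.mono fun z hz => (hball z hz).2,
    fun z hz => ⟨(hball z hz).1.1, (hball z hz).1.2.le⟩⟩

theorem hasFDerivAt_of_variational {F : V → V} {s : Set V} {C : NNReal} {K L T : ℝ}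
    (hs : Convex ℝ s) (hd : ∀ z ∈ s, DifferentiableAt ℝ F z)
    (hC : LipschitzOnWith C (fderiv ℝ F) s) (hK : ∀ z ∈ s, ‖fderiv ℝ F z‖ ≤ K) (hT : 0 ≤ T)
    {Z : V → ℝ → V} {z : V} {Y : ℝ → V →L[ℝ] V} (hZ0 : ∀ᶠ z' in 𝓝 z, Z z' 0 = z')
    (hZ : ∀ᶠ z' in 𝓝 z, ∀ t ∈ Icc 0 T, Z z' t ∈ s ∧ HasDerivAt (Z z') (F (Z z' t)) t)
    (hL : ∀ᶠ z' in 𝓝 z, ∀ t ∈ Icc 0 T, ‖Z z' t - Z z t‖ ≤ L * ‖z' - z‖)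
    (hY0 : Y 0 = .id ℝ V)
    (hY : ∀ t ∈ Icc 0 T, HasDerivAt Y ((fderiv ℝ F (Z z t)).comp (Y t)) t) :
    HasFDerivAt (fun z' => Z z' T) (Y T) z := by
  have hYv : ∀ v, ∀ t ∈ Icc 0 T, HasDerivAt (fun t => Y t v) (fderiv ℝ F (Z z t) (Y t v)) t :=
    fun v t ht => by simpa using (hY t ht).clm_apply (hasDerivAt_const t v)
  refine hasFDerivAt_of_norm_sub_sub_le_sq (C := C * L ^ 2 * gronwallBound 0 K 1 T) ?_
  filter_upwards [hZ0, hZ, hL] with z' hz0 hz' hdist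
  calc ‖Z z' T - Z z T - Y T (z' - z)‖ ≤ gronwallBound 0 K (C * (L * ‖z' - z‖) ^ 2) T :=
        norm_sub_sub_le_gronwallBound_of_variational hs hd hC hK
          (fun t ht => (hZ.self_of_nhds t ht).1) (fun t ht => (hz' t ht).1)
          (fun t ht => (hZ.self_of_nhds t ht).2) (fun t ht => (hz' t ht).2) (hYv (z' - z))
          (by simp [hz0, hZ0.self_of_nhds, hY0]) hdist ⟨hT, le_rfl⟩
    _ = C * L ^ 2 * gronwallBound 0 K 1 T * ‖z' - z‖ ^ 2 := by
        rw [gronwallBound_zero_left]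
        ring

/- The flow of the variational field is Lipschitz by Picard-Lindelöf; its first component is the
flow `Z` of `F` and its second one the derivative `Y` of `Z`. -/
theorem exists_flow_hasFDerivAt [CompleteSpace V] {F : V → V} {z₀ : V}
    (hF : ContDiffAt ℝ 2 F z₀) {W : Set V} (hW : W ∈ 𝓝 z₀) :
    ∃ r > 0, ∃ ε > 0, ∃ Z : V → ℝ → V, ∃ Y : V → ℝ → V →L[ℝ] V, ∀ z ∈ Metric.ball z₀ r,
      Z z 0 = z ∧ Y z 0 = ContinuousLinearMap.id ℝ V ∧ ∀ t ∈ Ico (0 : ℝ) ε,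
        Z z t ∈ W ∧ HasDerivAt (Z z) (F (Z z t)) t ∧
        HasDerivAt (Y z) ((fderiv ℝ F (Z z t)).comp (Y z t)) t ∧
        HasFDerivAt (fun z' => Z z' t) (Y z t) z := by
  obtain ⟨ρ, hρ, C, K, hC, hdK⟩ := exists_ball_lipschitzOnWith_fderiv hF
  let w : V → V × (V →L[ℝ] V) := fun z => (z, .id ℝ V)
  obtain ⟨r, hr, ε, hε, L, α, hα, hL⟩ := exists_local_flow_lipschitzOnWith
    (contDiffAt_variationalField (w := w z₀) hF)
    (continuousAt_fst.preimage_mem_nhds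
      (Filter.inter_mem (Metric.ball_mem_nhds z₀ hρ) hW))
  have hw : ∀ z ∈ Metric.ball z₀ r, w z ∈ Metric.ball (w z₀) r := fun z hz => by
    simpa [w, Prod.dist_eq, hr] using hz
  let Z : V → ℝ → V := fun z t => (α (w z) t).1
  let Y : V → ℝ → V →L[ℝ] V := fun z t => (α (w z) t).2
  have hpos : ∀ t ∈ Ico 0 ε, t ∈ Ioo (-ε) ε := fun t ht => ⟨(neg_lt_zero.2 hε).trans_le ht.1, ht.2⟩
  have hZ0 : ∀ z ∈ Metric.ball z₀ r, Z z 0 = z ∧ Y z 0 = .id ℝ V := fun z hz =>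
    Prod.ext_iff.1 (hα (w z) (hw z hz)).1
  have hZmem : ∀ z ∈ Metric.ball z₀ r, ∀ t ∈ Ico 0 ε, Z z t ∈ Metric.ball z₀ ρ ∧ Z z t ∈ W :=
    fun z hz t ht => ((hα (w z) (hw z hz)).2 t (hpos t ht)).1
  have hZY : ∀ z ∈ Metric.ball z₀ r, ∀ t ∈ Ico 0 ε, HasDerivAt (Z z) (F (Z z t)) t ∧
      HasDerivAt (Y z) ((fderiv ℝ F (Z z t)).comp (Y z t)) t := fun z hz t ht =>
    have h := ((hα (w z) (hw z hz)).2 t (hpos t ht)).2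
    ⟨h.fst, h.snd⟩
  have hZL : ∀ z ∈ Metric.ball z₀ r, ∀ z' ∈ Metric.ball z₀ r, ∀ t ∈ Ico 0 ε,
      ‖Z z' t - Z z t‖ ≤ L * ‖z' - z‖ := fun z hz z' hz' t ht => by
    simpa [w, Z] using (norm_fst_le (α (w z') t - α (w z) t)).trans
      ((hL t (hpos t ht)).norm_sub_le (hw z' hz') (hw z hz))
  refine ⟨r, hr, ε, hε, Z, Y, fun z hz => ⟨(hZ0 z hz).1, (hZ0 z hz).2, fun t ht =>
    ⟨(hZmem z hz t ht).2, (hZY z hz t ht).1, (hZY z hz t ht).2, ?_⟩⟩⟩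
  have hsub : ∀ s ∈ Icc 0 t, s ∈ Ico 0 ε := fun s hs => ⟨hs.1, hs.2.trans_lt ht.2⟩
  have hnear : ∀ᶠ z' in 𝓝 z, z' ∈ Metric.ball z₀ r := Metric.isOpen_ball.mem_nhds hz
  exact hasFDerivAt_of_variational (convex_ball z₀ ρ) (fun z hz => (hdK z hz).1) hC
    (fun z hz => (hdK z hz).2) ht.1 (hnear.mono fun z' hz' => (hZ0 z' hz').1)
    (hnear.mono fun z' hz' s hs =>
      ⟨(hZmem z' hz' s (hsub s hs)).1, (hZY z' hz' s (hsub s hs)).1⟩)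
    (hnear.mono fun z' hz' s hs => hZL z hz z' hz' s (hsub s hs)) (hZ0 z hz).2
    fun s hs => (hZY z hz s (hsub s hs)).2

end Flow

section Jacobi

variable {E : Type*} [NormedAddCommGroup E] [NormedSpace ℝ E]

theorem norm_sub_le_sub_of_norm_deriv_le_deriv {f f' : ℝ → E} {g g' : ℝ → ℝ} {a b : ℝ}
    (hf : ∀ s ∈ Icc a b, HasDerivAt f (f' s) s) (hg : ∀ s ∈ Icc a b, HasDerivAt g (g' s) s)
    (hfg : ∀ s ∈ Icc a b, ‖f' s‖ ≤ g' s) {s : ℝ} (hs : s ∈ Icc a b) :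
    ‖f s - f a‖ ≤ g b - g a := by
  have hgc : ContinuousOn g (Icc a b) := fun r hr => (hg r hr).continuousAt.continuousWithinAt
  have hmono : MonotoneOn g (Icc a b) := monotoneOn_of_hasDerivWithinAt_nonneg (convex_Icc a b)
    hgc (fun r hr => (hg r (interior_subset hr)).hasDerivWithinAt)
    (fun r hr => (norm_nonneg _).trans (hfg r (interior_subset hr)))
  calc ‖f s - f a‖ ≤ g s - g a :=
        image_norm_le_of_norm_deriv_right_le_deriv_boundary' (f := fun r => f r - f a)
          (B := fun r => g r - g a)
          (fun r hr => ((hf r hr).sub_const _).continuousAt.continuousWithinAt)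
          (fun r hr => ((hf r (Ico_subset_Icc_self hr)).sub_const _).hasDerivWithinAt) (by simp)
          (hgc.sub continuousOn_const)
          (fun r hr => ((hg r (Ico_subset_Icc_self hr)).sub_const _).hasDerivWithinAt)
          (fun r hr => hfg r (Ico_subset_Icc_self hr)) hs
    _ ≤ g b - g a := sub_le_sub_right (hmono hs ⟨hs.1.trans hs.2, le_rfl⟩ hs.2) _

theorem norm_sq_apply_le_of_symm_nonneg {P : (E →L[ℝ] ℝ) →L[ℝ] E} {K : ℝ}
    (hsymm : ∀ η ζ : E →L[ℝ] ℝ, η (P ζ) = ζ (P η)) (hpos : ∀ η : E →L[ℝ] ℝ, 0 ≤ η (P η))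
    (hK : ‖P‖ ≤ K) (η : E →L[ℝ] ℝ) : ‖P η‖ ^ 2 ≤ K * η (P η) := by
  have hK₀ : 0 ≤ K := (norm_nonneg P).trans hK
  obtain ⟨ζ, hζ_norm, hζ⟩ := exists_dual_vector'' ℝ (P η)
  have hcs : ζ (P η) * η (P ζ) ≤ ζ (P ζ) * η (P η) :=
    LinearMap.BilinForm.apply_mul_apply_le_of_forall_zero_le
      (LinearMap.mk₂ ℝ (fun a b : E →L[ℝ] ℝ => a (P b)) (by simp) (by simp) (by simp) (by simp))
      hpos ζ η
  have hζP : ζ (P ζ) ≤ K := calc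
    ζ (P ζ) ≤ ‖ζ (P ζ)‖ := le_abs_self _
    _ ≤ ‖ζ‖ * (‖P‖ * ‖ζ‖) := ζ.le_opNorm_of_le (P.le_opNorm ζ)
    _ ≤ 1 * (K * 1) := by gcongr
    _ = K := by ring
  calc ‖P η‖ ^ 2 = ζ (P η) * η (P ζ) := by
        rw [hsymm η ζ, hζ, sq]
        rfl
    _ ≤ ζ (P ζ) * η (P η) := hcs
    _ ≤ K * η (P η) := mul_le_mul_of_nonneg_right hζP (hpos η)

/-- The operators `A`, `P`, `C`, of norm at most `K`, are the coefficients of the quadratic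
Hamiltonian `ξ (P ξ) / 2 + ξ (A x) - C x x / 2`, and this Hamiltonian is nonnegative in the
momentum `ξ`. -/
structure IsMomentumNonneg (A : E →L[ℝ] E) (P : (E →L[ℝ] ℝ) →L[ℝ] E) (C : E →L[ℝ] E →L[ℝ] ℝ)
    (K : ℝ) : Prop where
  symm : ∀ η ζ : E →L[ℝ] ℝ, η (P ζ) = ζ (P η)
  nonneg : ∀ η : E →L[ℝ] ℝ, 0 ≤ η (P η)
  norm_pos_le : ‖A‖ ≤ K
  norm_mom_le : ‖P‖ ≤ K
  norm_pot_le : ‖C‖ ≤ K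

/-- A Jacobi field: the curve `(x, ξ)` solves on `[0, t]` the linear Hamiltonian system with
coefficients `A`, `P`, `C`. -/
structure IsJacobiField (A : ℝ → E →L[ℝ] E) (P : ℝ → (E →L[ℝ] ℝ) →L[ℝ] E)
    (C : ℝ → E →L[ℝ] E →L[ℝ] ℝ) (t : ℝ) (x : ℝ → E) (ξ : ℝ → E →L[ℝ] ℝ) : Prop where
  hasDerivAt_fst : ∀ s ∈ Icc 0 t, HasDerivAt x (A s (x s) + P s (ξ s)) s
  hasDerivAt_snd : ∀ s ∈ Icc 0 t, HasDerivAt ξ (C s (x s) - (ξ s).comp (A s)) s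

/- AM-GM turns `‖P ξ‖² ≤ K ξ(P ξ)` into a bound which is affine in the derivative
`ξ(P ξ) + C x x` of the pairing `ξ(x)`. -/
theorem IsMomentumNonneg.norm_apply_add_apply_le {A : E →L[ℝ] E} {P : (E →L[ℝ] ℝ) →L[ℝ] E}
    {C : E →L[ℝ] E →L[ℝ] ℝ} {K M : ℝ} (h : IsMomentumNonneg A P C K) (hM : 0 < M) {x : E}
    (hx : ‖x‖ ≤ M) (ξ : E →L[ℝ] ℝ) :
    ‖A x + P ξ‖ ≤ M * (1 + K) ^ 2 / 2 + K / (2 * M) * (ξ (P ξ) + C x x) := by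
  have hK : 0 ≤ K := (norm_nonneg _).trans h.norm_pos_le
  have hAx : ‖A x‖ ≤ K * M := A.le_of_opNorm_le_of_le h.norm_pos_le hx
  have hPξ : ‖P ξ‖ ≤ M / 2 + K / (2 * M) * ξ (P ξ) := calc
    ‖P ξ‖ ≤ (M ^ 2 + ‖P ξ‖ ^ 2) / (2 * M) := by
      rw [le_div_iff₀ (by positivity)]
      linarith [two_mul_le_add_sq M ‖P ξ‖]
    _ ≤ (M ^ 2 + K * ξ (P ξ)) / (2 * M) := by
      gcongr
      exact norm_sq_apply_le_of_symm_nonneg h.symm h.nonneg h.norm_mom_le ξ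
    _ = M / 2 + K / (2 * M) * ξ (P ξ) := by field_simp
  have hCx : -(K * M ^ 2) ≤ C x x := neg_le_of_abs_le <| calc
    |C x x| ≤ ‖C‖ * ‖x‖ * ‖x‖ := C.le_opNorm₂ x x
    _ ≤ K * M * M := by gcongr; exact h.norm_pot_le
    _ = K * M ^ 2 := by ring
  calc ‖A x + P ξ‖ ≤ K * M + (M / 2 + K / (2 * M) * ξ (P ξ)) := norm_add_le_of_le hAx hPξ
    _ = M * (1 + K) ^ 2 / 2 + K / (2 * M) * (ξ (P ξ) + -(K * M ^ 2)) := by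
        field_simp
        ring
    _ ≤ M * (1 + K) ^ 2 / 2 + K / (2 * M) * (ξ (P ξ) + C x x) := by gcongr

namespace IsJacobiField

variable {A : ℝ → E →L[ℝ] E} {P : ℝ → (E →L[ℝ] ℝ) →L[ℝ] E} {C : ℝ → E →L[ℝ] E →L[ℝ] ℝ} {t : ℝ}
  {x : ℝ → E} {ξ : ℝ → E →L[ℝ] ℝ}

theorem hasDerivAt_pairing (h : IsJacobiField A P C t x ξ) {s : ℝ} (hs : s ∈ Icc 0 t) :
    HasDerivAt (fun s => ξ s (x s)) (ξ s (P s (ξ s)) + C s (x s) (x s)) s := by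
  refine ((h.hasDerivAt_snd s hs).clm_apply (h.hasDerivAt_fst s hs)).congr_deriv ?_
  simp only [sub_apply, ContinuousLinearMap.comp_apply, map_add]
  ring

theorem norm_fst_le (h : IsJacobiField A P C t x ξ) {K M : ℝ}
    (hAPC : ∀ s ∈ Icc 0 t, IsMomentumNonneg (A s) (P s) (C s) K) (hM : 0 < M)
    (hxM : ∀ s ∈ Icc 0 t, ‖x s‖ ≤ M) (h0 : x 0 = 0) (ht : x t = 0) {s : ℝ} (hs : s ∈ Icc 0 t) :
    ‖x s‖ ≤ M * (t * (1 + K) ^ 2 / 2) := by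
  have hg : ∀ r ∈ Icc 0 t,
      HasDerivAt (fun r => M * (1 + K) ^ 2 / 2 * r + K / (2 * M) * ξ r (x r))
        (M * (1 + K) ^ 2 / 2 + K / (2 * M) * (ξ r (P r (ξ r)) + C r (x r) (x r))) r :=
    fun r hr => by
      simpa using ((hasDerivAt_id r).const_mul (M * (1 + K) ^ 2 / 2)).fun_add
        ((h.hasDerivAt_pairing hr).const_mul (K / (2 * M)))
  calc ‖x s‖ = ‖x s - x 0‖ := by rw [h0, sub_zero]
    _ ≤ _ := norm_sub_le_sub_of_norm_deriv_le_deriv h.hasDerivAt_fst hg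
        (fun r hr => (hAPC r hr).norm_apply_add_apply_le hM (hxM r hr) (ξ r)) hs
    _ = M * (t * (1 + K) ^ 2 / 2) := by
        simp only [h0, ht, map_zero]
        ring

theorem fst_eq_zero (h : IsJacobiField A P C t x ξ) {K : ℝ}
    (hAPC : ∀ s ∈ Icc 0 t, IsMomentumNonneg (A s) (P s) (C s) K) (htK : t * (1 + K) ^ 2 < 2)
    (h0 : x 0 = 0) (ht : x t = 0) {s : ℝ} (hs : s ∈ Icc 0 t) : x s = 0 := by
  have hxc : ContinuousOn x (Icc 0 t) := fun s hs =>
    (h.hasDerivAt_fst s hs).continuousAt.continuousWithinAt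
  obtain ⟨m, hm, hmax⟩ := isCompact_Icc.exists_isMaxOn ⟨s, hs⟩ hxc.norm
  suffices hxm : ‖x m‖ ≤ 0 from norm_le_zero_iff.1 ((hmax hs).trans hxm)
  by_contra! hpos
  have hle := h.norm_fst_le hAPC hpos (fun s hs => hmax hs) h0 ht hm
  exact absurd hle (not_le.2 (mul_lt_of_lt_one_right hpos (by linarith)))

end IsJacobiField

end Jacobi

section Cometric

variable {E : Type*} [NormedAddCommGroup E] [NormedSpace ℝ E]

/-- The Hamiltonian vector field of `(x, ξ) ↦ ξ (B x ξ) / 2`. -/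
noncomputable def cometricField (B : E → (E →L[ℝ] ℝ) →L[ℝ] E) (z : E × (E →L[ℝ] ℝ)) :
    E × (E →L[ℝ] ℝ) :=
  (B z.1 z.2, -(1 / 2 : ℝ) • z.2.comp ((fderiv ℝ B z.1).flip z.2))

/-- The coefficient `∂²H/∂x∂ξ` of the linearization of `cometricField B` at `z`. -/
noncomputable def cometricPosCoeff (B : E → (E →L[ℝ] ℝ) →L[ℝ] E) (z : E × (E →L[ℝ] ℝ)) :
    E →L[ℝ] E :=
  (fderiv ℝ B z.1).flip z.2

/-- The coefficient `-∂²H/∂x²` of the linearization of `cometricField B` at `z`. -/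
noncomputable def cometricPotCoeff (B : E → (E →L[ℝ] ℝ) →L[ℝ] E) (z : E × (E →L[ℝ] ℝ)) :
    E →L[ℝ] E →L[ℝ] ℝ :=
  (ContinuousLinearMap.snd ℝ E (E →L[ℝ] ℝ)).comp
    ((fderiv ℝ (cometricField B) z).comp (ContinuousLinearMap.inl ℝ E (E →L[ℝ] ℝ)))

theorem contDiffAt_cometricField {B : E → (E →L[ℝ] ℝ) →L[ℝ] E} {z : E × (E →L[ℝ] ℝ)}
    (hB : ContDiffAt ℝ ∞ B z.1) : ContDiffAt ℝ ∞ (cometricField B) z := by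
  have hflip : ContDiffAt ℝ ∞ (fun z : E × (E →L[ℝ] ℝ) => (fderiv ℝ B z.1).flip) z :=
    (ContinuousLinearMap.flipₗᵢ ℝ E (E →L[ℝ] ℝ) E).contDiff.contDiffAt.comp z
      ((hB.fderiv_right (m := ∞) (by simp)).comp z contDiffAt_fst)
  exact ((hB.comp z contDiffAt_fst).clm_apply contDiffAt_snd).prodMk
    ((contDiffAt_snd.clm_comp (hflip.clm_apply contDiffAt_snd)).const_smul (-(1 / 2 : ℝ)))

theorem fderiv_apply_symm {B : E → (E →L[ℝ] ℝ) →L[ℝ] E} {x : E} (hB : DifferentiableAt ℝ B x)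
    (hsymm : ∀ᶠ y in 𝓝 x, ∀ η ζ : E →L[ℝ] ℝ, η (B y ζ) = ζ (B y η)) (u : E)
    (η ζ : E →L[ℝ] ℝ) : η (fderiv ℝ B x u ζ) = ζ (fderiv ℝ B x u η) := by
  have hpair : ∀ η ζ : E →L[ℝ] ℝ,
      HasFDerivAt (fun y => η (B y ζ)) (η.comp ((fderiv ℝ B x).flip ζ)) x := fun η ζ =>
    η.hasFDerivAt.comp x ((hB.hasFDerivAt.clm_apply (hasFDerivAt_const ζ x)).congr_fderiv
      (by ext; simp))
  have hunique := (hpair η ζ).unique <| (hpair ζ η).congr_of_eventuallyEq <|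
    hsymm.mono fun y hy => hy η ζ
  simpa using congrArg (fun L : E →L[ℝ] ℝ => L u) hunique

theorem deriv_apply_eq_of_parallel {α β : ℝ → E →L[ℝ] ℝ} {α' β' : E →L[ℝ] ℝ} {I : Set ℝ} {a f : ℝ}
    (hI : UniqueDiffWithinAt ℝ I a) (ha : a ∈ I) (hα : HasDerivWithinAt α α' I a)
    (hβ : HasDerivWithinAt β β' I a) (hpar : ∀ s ∈ I, ∃ c : ℝ, c • α s = β s)
    (hne : α a ≠ 0) (hf : f • α a = β a) {u : E} (hu : α a u = 0) : β' u = f * α' u := by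
  obtain ⟨r, hr⟩ : ∃ r, α a r ≠ 0 := by
    by_contra! h
    exact hne (ContinuousLinearMap.ext h)
  have happly : ∀ {γ : ℝ → E →L[ℝ] ℝ} {γ' : E →L[ℝ] ℝ} (w : E), HasDerivWithinAt γ γ' I a →
      HasDerivWithinAt (fun s => γ s w) (γ' w) I a := fun w hγ => by
    simpa using hγ.clm_apply (hasDerivWithinAt_const a I w)
  have hdet : ∀ s ∈ I, α s r * β s u = β s r * α s u := fun s hs => by
    obtain ⟨c, hc⟩ := hpar s hs
    simp only [← hc, smul_apply, smul_eq_mul]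
    ring
  have hderiv : α' r * β a u + α a r * β' u = β' r * α a u + β a r * α' u :=
    hI.eq_deriv I ((happly r hα).fun_mul (happly u hβ)) <|
      ((happly r hβ).fun_mul (happly u hα)).congr hdet (hdet a ha)
  simp only [← hf, smul_apply, smul_eq_mul, hu, mul_zero, zero_add] at hderiv
  exact mul_left_cancel₀ hr (by linear_combination hderiv)

/-- `B` is a smooth symmetric nonnegative cometric on the open set `Ω` whose kernel is spanned by
the 1-form `θ`, and `dθ` is nondegenerate on the kernel of `θ` at `x₀`. -/
structure IsContactCometric (B : E → (E →L[ℝ] ℝ) →L[ℝ] E) (θ : E → E →L[ℝ] ℝ) (Ω : Set E)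
    (x₀ : E) : Prop where
  isOpen : IsOpen Ω
  mem : x₀ ∈ Ω
  contDiffOn : ContDiffOn ℝ ∞ B Ω
  symm : ∀ x ∈ Ω, ∀ η ζ : E →L[ℝ] ℝ, η (B x ζ) = ζ (B x η)
  nonneg : ∀ x ∈ Ω, ∀ η : E →L[ℝ] ℝ, 0 ≤ η (B x η)
  apply_eq_zero_iff : ∀ x ∈ Ω, ∀ η : E →L[ℝ] ℝ, B x η = 0 ↔ ∃ f : ℝ, f • θ x = η
  form_ne : θ x₀ ≠ 0
  differentiableAt : DifferentiableAt ℝ θ x₀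
  nondegenerate : ∀ v, v ≠ 0 → θ x₀ v = 0 → ∃ u, θ x₀ u = 0 ∧ dOneForm θ x₀ v u ≠ 0

namespace IsContactCometric

variable {B : E → (E →L[ℝ] ℝ) →L[ℝ] E} {θ : E → E →L[ℝ] ℝ} {Ω : Set E} {x₀ : E}

theorem contDiffAt (h : IsContactCometric B θ Ω x₀) {x : E} (hx : x ∈ Ω) : ContDiffAt ℝ ∞ B x :=
  h.contDiffOn.contDiffAt (h.isOpen.mem_nhds hx)

theorem hasFDerivAt (h : IsContactCometric B θ Ω x₀) {x : E} (hx : x ∈ Ω) :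
    HasFDerivAt B (fderiv ℝ B x) x :=
  ((h.contDiffAt hx).differentiableAt (by simp)).hasFDerivAt

theorem fderiv_symm (h : IsContactCometric B θ Ω x₀) {x : E} (hx : x ∈ Ω) (u : E)
    (η ζ : E →L[ℝ] ℝ) : η (fderiv ℝ B x u ζ) = ζ (fderiv ℝ B x u η) :=
  fderiv_apply_symm (h.hasFDerivAt hx).differentiableAt
    (Filter.eventually_of_mem (h.isOpen.mem_nhds hx) h.symm) u η ζ

theorem apply_form (h : IsContactCometric B θ Ω x₀) {x : E} (hx : x ∈ Ω) : B x (θ x) = 0 :=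
  (h.apply_eq_zero_iff x hx _).2 ⟨1, one_smul ℝ _⟩

theorem fderiv_apply_form (h : IsContactCometric B θ Ω x₀) (u : E) :
    fderiv ℝ B x₀ u (θ x₀) = -B x₀ (fderiv ℝ θ x₀ u) := by
  have hzero : HasFDerivAt (fun y => B y (θ y)) (0 : E →L[ℝ] E) x₀ :=
    (hasFDerivAt_const (0 : E) x₀).congr_of_eventuallyEq <|
      Filter.eventually_of_mem (h.isOpen.mem_nhds h.mem) fun _ hy => h.apply_form hy
  have hsum : B x₀ (fderiv ℝ θ x₀ u) + fderiv ℝ B x₀ u (θ x₀) = 0 := by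
    simpa using congrArg (fun L : E →L[ℝ] E => L u)
      (((h.hasFDerivAt h.mem).clm_apply h.differentiableAt.hasFDerivAt).unique hzero)
  exact eq_neg_of_add_eq_zero_right hsum

theorem fderiv_cometricField_inr (h : IsContactCometric B θ Ω x₀) {z : E × (E →L[ℝ] ℝ)}
    (hz : z.1 ∈ Ω) (η : E →L[ℝ] ℝ) :
    fderiv ℝ (cometricField B) z (0, η) = (B z.1 η, -η.comp (cometricPosCoeff B z)) := by
  have hF : DifferentiableAt ℝ (cometricField B) z :=
    (contDiffAt_cometricField (h.contDiffAt hz)).differentiableAt (by simp)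
  have hpartial : HasFDerivAt (fun ζ => cometricField B (z.1, ζ))
      ((fderiv ℝ (cometricField B) z).comp (ContinuousLinearMap.inr ℝ E (E →L[ℝ] ℝ))) z.2 :=
    HasFDerivAt.comp (g := cometricField B) z.2 hF.hasFDerivAt (hasFDerivAt_prodMk_right z.1 z.2)
  have hmom := ((hasFDerivAt_id (𝕜 := ℝ) z.2).clm_comp
    ((fderiv ℝ B z.1).flip.hasFDerivAt (x := z.2))).const_smul (-(1 / 2 : ℝ))
  have hη := congrArg (fun L => L η)
    (hpartial.unique ((B z.1).hasFDerivAt (x := z.2) |>.prodMk hmom))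
  refine hη.trans (Prod.ext rfl (ContinuousLinearMap.ext fun u => ?_))
  have hsymm := h.fderiv_symm hz u z.2 η
  simp only [cometricPosCoeff, ContinuousLinearMap.prod_apply, smul_apply, add_apply, neg_apply,
    ContinuousLinearMap.comp_apply, ContinuousLinearMap.compL_apply,
    ContinuousLinearMap.flip_apply, ContinuousLinearMap.id_apply, smul_eq_mul, id_eq, hsymm]
  ring

theorem fst_fderiv_cometricField_inl (h : IsContactCometric B θ Ω x₀) {z : E × (E →L[ℝ] ℝ)}
    (hz : z.1 ∈ Ω) (w : E) :
    (fderiv ℝ (cometricField B) z (w, 0)).1 = cometricPosCoeff B z w := by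
  have hF : DifferentiableAt ℝ (cometricField B) z :=
    (contDiffAt_cometricField (h.contDiffAt hz)).differentiableAt (by simp)
  have hfst : HasFDerivAt (fun y : E × (E →L[ℝ] ℝ) => B y.1 y.2) _ z :=
    ((h.hasFDerivAt hz).comp z hasFDerivAt_fst).clm_apply hasFDerivAt_snd
  simpa [cometricPosCoeff] using
    congrArg (fun L => L (w, 0)) (hF.hasFDerivAt.fst.unique hfst)

theorem fderiv_cometricField_apply (h : IsContactCometric B θ Ω x₀) {z : E × (E →L[ℝ] ℝ)}
    (hz : z.1 ∈ Ω) (w : E) (η : E →L[ℝ] ℝ) : fderiv ℝ (cometricField B) z (w, η) =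
      (cometricPosCoeff B z w + B z.1 η,
        cometricPotCoeff B z w - η.comp (cometricPosCoeff B z)) := by
  have hsplit : (w, η) = (w, (0 : E →L[ℝ] ℝ)) + ((0 : E), η) := by simp
  rw [hsplit, map_add, h.fderiv_cometricField_inr hz, ← h.fst_fderiv_cometricField_inl hz w,
    sub_eq_add_neg]
  rfl

theorem isMomentumNonneg (h : IsContactCometric B θ Ω x₀) {z : E × (E →L[ℝ] ℝ)} (hz : z.1 ∈ Ω)
    {K : ℝ} (hK : ‖fderiv ℝ (cometricField B) z‖ ≤ K) :
    IsMomentumNonneg (cometricPosCoeff B z) (B z.1) (cometricPotCoeff B z) K := by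
  have hK₀ : 0 ≤ K := (norm_nonneg _).trans hK
  have hbound : ∀ w η, ‖fderiv ℝ (cometricField B) z (w, η)‖ ≤ K * ‖(w, η)‖ := fun w η =>
    ContinuousLinearMap.le_of_opNorm_le _ hK _
  refine ⟨h.symm _ hz, h.nonneg _ hz, ?_, ?_, ?_⟩
  · refine ContinuousLinearMap.opNorm_le_bound _ hK₀ fun w => ?_
    rw [← h.fst_fderiv_cometricField_inl hz]
    exact (norm_fst_le _).trans ((hbound w 0).trans_eq (by simp [Prod.norm_def]))
  · refine ContinuousLinearMap.opNorm_le_bound _ hK₀ fun η => ?_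
    have hη : B z.1 η = (fderiv ℝ (cometricField B) z (0, η)).1 := by
      rw [h.fderiv_cometricField_inr hz]
    rw [hη]
    exact (norm_fst_le _).trans ((hbound 0 η).trans_eq (by simp [Prod.norm_def]))
  · exact ContinuousLinearMap.opNorm_le_bound _ hK₀ fun w =>
      (norm_snd_le _).trans ((hbound w 0).trans_eq (by simp [Prod.norm_def]))

theorem isJacobiField_of_variational (h : IsContactCometric B θ Ω x₀) {t : ℝ}
    {z y : ℝ → E × (E →L[ℝ] ℝ)} (hz : ∀ s ∈ Icc 0 t, (z s).1 ∈ Ω)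
    (hy : ∀ s ∈ Icc 0 t, HasDerivAt y (fderiv ℝ (cometricField B) (z s) (y s)) s) :
    IsJacobiField (fun s => cometricPosCoeff B (z s)) (fun s => B (z s).1)
      (fun s => cometricPotCoeff B (z s)) t (fun s => (y s).1) (fun s => (y s).2) := by
  have hy' := fun s hs => (hy s hs).congr_deriv
    (h.fderiv_cometricField_apply (hz s hs) (y s).1 (y s).2)
  exact ⟨fun s hs => (hy' s hs).fst, fun s hs => (hy' s hs).snd⟩

/- The momentum stays in the kernel of the cometric, so it is `f θ`; comparing its derivative with
that of `θ` gives `f dθ(B ξ₀, u) = 0` for all `u ∈ ker θ`. -/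
theorem isJacobiField_snd_eq_zero (h : IsContactCometric B θ Ω x₀) {x : ℝ → E}
    {η : ℝ → E →L[ℝ] ℝ} {ξ₀ : E →L[ℝ] ℝ} {t : ℝ} (ht : 0 < t) (hξ₀ : B x₀ ξ₀ ≠ 0) (hx0 : x 0 = x₀)
    (hxΩ : ∀ s ∈ Icc 0 t, x s ∈ Ω) (hx : HasDerivAt x (B x₀ ξ₀) 0)
    (hη : HasDerivAt η (-(η 0).comp (cometricPosCoeff B (x₀, ξ₀))) 0)
    (hker : ∀ s ∈ Icc 0 t, B (x s) (η s) = 0) : η 0 = 0 := by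
  subst hx0
  have h0 : (0 : ℝ) ∈ Icc 0 t := left_mem_Icc.2 ht.le
  have hpar : ∀ s ∈ Icc 0 t, ∃ c : ℝ, c • θ (x s) = η s := fun s hs =>
    (h.apply_eq_zero_iff _ (hxΩ s hs) _).1 (hker s hs)
  obtain ⟨f, hf⟩ := hpar 0 h0
  have hhor : θ (x 0) (B (x 0) ξ₀) = 0 := by
    rw [h.symm _ h.mem, h.apply_form h.mem, map_zero]
  obtain ⟨u, hu, hdu⟩ := h.nondegenerate _ hξ₀ hhor
  have hderiv : -(f * ξ₀ (fderiv ℝ B (x 0) u (θ (x 0)))) =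
      f * fderiv ℝ θ (x 0) (B (x 0) ξ₀) u := by
    simpa [cometricPosCoeff, ← hf, h.fderiv_symm h.mem u ξ₀] using
      deriv_apply_eq_of_parallel (uniqueDiffOn_Icc ht 0 h0) h0
        (h.differentiableAt.hasFDerivAt.comp_hasDerivAt 0 hx).hasDerivWithinAt
        hη.hasDerivWithinAt hpar h.form_ne hf hu
  rw [h.fderiv_apply_form, map_neg, h.symm _ h.mem] at hderiv
  have hf0 : f * dOneForm θ (x 0) (B (x 0) ξ₀) u = 0 := by
    unfold dOneForm
    linear_combination -hderiv
  rw [← hf, (mul_eq_zero.1 hf0).resolve_right hdu, zero_smul]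

theorem eq_zero_of_variational (h : IsContactCometric B θ Ω x₀) {ξ η : E →L[ℝ] ℝ} {t K : ℝ}
    {z y : ℝ → E × (E →L[ℝ] ℝ)} (ht : 0 < t) (htK : t * (1 + K) ^ 2 < 2) (hξ : B x₀ ξ ≠ 0)
    (hz0 : z 0 = (x₀, ξ)) (hzΩ : ∀ s ∈ Icc 0 t, (z s).1 ∈ Ω)
    (hz : ∀ s ∈ Icc 0 t, HasDerivAt z (cometricField B (z s)) s)
    (hK : ∀ s ∈ Icc 0 t, ‖fderiv ℝ (cometricField B) (z s)‖ ≤ K) (hy0 : y 0 = (0, η))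
    (hy : ∀ s ∈ Icc 0 t, HasDerivAt y (fderiv ℝ (cometricField B) (z s) (y s)) s)
    (hyt : (y t).1 = 0) : η = 0 := by
  have h0 : (0 : ℝ) ∈ Icc 0 t := left_mem_Icc.2 ht.le
  have hJ := h.isJacobiField_of_variational hzΩ hy
  have hfst : ∀ s ∈ Icc 0 t, (y s).1 = 0 := fun s hs =>
    hJ.fst_eq_zero (fun s hs => h.isMomentumNonneg (hzΩ s hs) (hK s hs)) htK (by simp [hy0]) hyt hs
  have hker : ∀ s ∈ Icc 0 t, B (z s).1 (y s).2 = 0 := fun s hs => by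
    simpa [hfst s hs] using (uniqueDiffOn_Icc ht s hs).eq_deriv _
      (hJ.hasDerivAt_fst s hs).hasDerivWithinAt
      ((hasDerivWithinAt_const s (Icc 0 t) (0 : E)).congr hfst (hfst s hs))
  have hx : HasDerivAt (fun s => (z s).1) (cometricField B (z 0)).1 0 := (hz 0 h0).fst
  rw [hz0] at hx
  have hη : HasDerivAt (fun s => (y s).2) (-(y 0).2.comp (cometricPosCoeff B (x₀, ξ))) 0 := by
    simpa [hz0, hy0] using hJ.hasDerivAt_snd 0 h0
  simpa [hy0] using h.isJacobiField_snd_eq_zero ht hξ (by simp [hz0]) hzΩ hx hη hker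

end IsContactCometric

end Cometric

section LocalExponential

variable {E : Type*} [NormedAddCommGroup E] [NormedSpace ℝ E]

theorem surjective_of_apply_eq_zero_imp [FiniteDimensional ℝ E] {D : (E →L[ℝ] ℝ) →L[ℝ] E}
    (hD : ∀ η, D η = 0 → η = 0) : Function.Surjective D := by
  have hfinrank : Module.finrank ℝ (E →L[ℝ] ℝ) = Module.finrank ℝ E :=
    (LinearMap.toContinuousLinearMap (𝕜 := ℝ) (E := E) (F' := ℝ)).symm.finrank_eq.trans
      Subspace.dual_finrank_eq
  exact (LinearMap.injective_iff_surjective_of_finrank_eq_finrank (f := (D : _ →ₗ[ℝ] E))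
    hfinrank).1 ((injective_iff_map_eq_zero _).2 hD)

theorem IsContactCometric.exists_eventually_norm_fderiv_cometricField_lt
    {B : E → (E →L[ℝ] ℝ) →L[ℝ] E} {θ : E → E →L[ℝ] ℝ} {Ω : Set E} {x₀ : E}
    (h : IsContactCometric B θ Ω x₀) (ξ₀ : E →L[ℝ] ℝ) :
    ∃ K > 0, ∀ᶠ z in 𝓝 (x₀, ξ₀), z.1 ∈ Ω ∧ ‖fderiv ℝ (cometricField B) z‖ < K := by
  have hF : ContDiffAt ℝ ∞ (cometricField B) (x₀, ξ₀) :=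
    contDiffAt_cometricField (h.contDiffAt h.mem)
  refine ⟨‖fderiv ℝ (cometricField B) (x₀, ξ₀)‖ + 1, by positivity, ?_⟩
  exact (continuousAt_fst.eventually_mem (h.isOpen.mem_nhds h.mem)).and <|
    (hF.fderiv_right (m := ∞) (by simp)).continuousAt.norm.eventually_lt
      continuousAt_const (lt_add_one _)

theorem IsContactCometric.exists_flow [FiniteDimensional ℝ E]
    {B : E → (E →L[ℝ] ℝ) →L[ℝ] E} {θ : E → E →L[ℝ] ℝ} {Ω : Set E} {x₀ : E}
    (h : IsContactCometric B θ Ω x₀) {ξ₀ : E →L[ℝ] ℝ} (hξ₀ : B x₀ ξ₀ ≠ 0) :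
    ∃ r > 0, ∃ ε > 0, ∃ Z : (E →L[ℝ] ℝ) → ℝ → E × (E →L[ℝ] ℝ), ∀ ξ ∈ Metric.ball ξ₀ r,
      Z ξ 0 = (x₀, ξ) ∧ ∀ t ∈ Ico (0 : ℝ) ε, (Z ξ t).1 ∈ Ω ∧
        HasDerivAt (Z ξ) (cometricField B (Z ξ t)) t ∧
        ∃ D : (E →L[ℝ] ℝ) →L[ℝ] E, HasFDerivAt (fun ξ' => (Z ξ' t).1) D ξ ∧
          (0 < t → Function.Surjective D) := by
  obtain ⟨K, hK, hW⟩ := h.exists_eventually_norm_fderiv_cometricField_lt ξ₀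
  obtain ⟨r, hr, ε, hε, Z, Y, hZ⟩ := exists_flow_hasFDerivAt
    ((contDiffAt_cometricField (z := (x₀, ξ₀)) (h.contDiffAt h.mem)).of_le (by norm_cast)) hW
  obtain ⟨r', hr', hBr'⟩ := Metric.eventually_nhds_iff_ball.1
    ((B x₀).continuous.continuousAt.eventually_ne hξ₀)
  refine ⟨min r r', lt_min hr hr', min ε (1 / (1 + K) ^ 2), lt_min hε (by positivity),
    fun ξ => Z (x₀, ξ), fun ξ hξ => ?_⟩
  have hzr : (x₀, ξ) ∈ Metric.ball (x₀, ξ₀) r := by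
    simpa [Prod.dist_eq, hr] using (lt_min_iff.1 hξ).1
  obtain ⟨hZ0, hY0, hZt⟩ := hZ _ hzr
  refine ⟨hZ0, fun t ht => ?_⟩
  have htK : t * (1 + K) ^ 2 < 1 :=
    (lt_div_iff₀ (by positivity)).1 (ht.2.trans_le (min_le_right _ _))
  have hsub : ∀ s ∈ Icc 0 t, s ∈ Ico 0 ε := fun s hs =>
    ⟨hs.1, hs.2.trans_lt (ht.2.trans_le (min_le_left _ _))⟩
  obtain ⟨⟨hΩ, -⟩, hderiv, -, hfderiv⟩ := hZt t (hsub t ⟨ht.1, le_rfl⟩)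
  refine ⟨hΩ, hderiv, (ContinuousLinearMap.fst ℝ E (E →L[ℝ] ℝ)).comp
    ((Y (x₀, ξ) t).comp (ContinuousLinearMap.inr ℝ E (E →L[ℝ] ℝ))),
    (hfderiv.comp ξ (hasFDerivAt_prodMk_right x₀ ξ)).fst, fun htpos =>
    surjective_of_apply_eq_zero_imp fun η hη => ?_⟩
  exact h.eq_zero_of_variational (y := fun s => Y (x₀, ξ) s (0, η)) htpos (by linarith)
    (hBr' ξ (Metric.ball_subset_ball (min_le_right _ _) hξ)) hZ0
    (fun s hs => (hZt s (hsub s hs)).1.1) (fun s hs => (hZt s (hsub s hs)).2.1)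
    (fun s hs => (hZt s (hsub s hs)).1.2.le) (by simp [hY0])
    (fun s hs => by
      simpa using (hZt s (hsub s hs)).2.2.1.clm_apply (hasDerivAt_const s ((0 : E), η))) hη

end LocalExponential

section Wedge

variable {E : Type*} [AddCommGroup E] [Module ℝ E]

theorem fin_eq_zero_or_odd_or_even {n : ℕ} (i : Fin (2 * n + 1)) :
    i = 0 ∨ (∃ k : Fin n, i = ⟨2 * (k : ℕ) + 1, by omega⟩) ∨
      ∃ k : Fin n, i = ⟨2 * (k : ℕ) + 2, by omega⟩ := by
  obtain ⟨i, hi⟩ := i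
  simp only [Fin.ext_iff, Fin.exists_iff, Fin.val_zero]
  rcases Nat.even_or_odd' i with ⟨m, rfl | rfl⟩
  · rcases m with _ | m
    · exact .inl rfl
    · exact .inr (.inr ⟨m, by omega, by ring⟩)
  · exact .inr (.inl ⟨m, by omega, rfl⟩)

theorem exists_linearMap_eq_prod {ι : Type*} [Fintype ι] {f : ι → E → ℝ} {j : ι} {L : E →ₗ[ℝ] ℝ}
    (hL : ∀ x, f j x = L x) (hconst : ∀ k ≠ j, ∀ x, f k x = f k 0) :
    ∃ L' : E →ₗ[ℝ] ℝ, ∀ x, ∏ k, f k x = L' x := by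
  classical
  refine ⟨(∏ k ∈ Finset.univ.erase j, f k 0) • L, fun x => ?_⟩
  rw [← Finset.mul_prod_erase _ _ (Finset.mem_univ j), hL, mul_comm, LinearMap.smul_apply,
    smul_eq_mul, Finset.prod_congr rfl fun k hk => hconst k (Finset.ne_of_mem_erase hk) x]

theorem exists_linearMap_eq_wedge_update {n : ℕ} (a : E →ₗ[ℝ] ℝ) (b : E →ₗ[ℝ] E →ₗ[ℝ] ℝ)
    [DecidableEq (Fin (2 * n + 1))] (w : Fin (2 * n + 1) → E) (i : Fin (2 * n + 1)) :
    ∃ L : E →ₗ[ℝ] ℝ, ∀ x, a (Function.update w i x 0) *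
      ∏ k : Fin n, b (Function.update w i x ⟨2 * (k : ℕ) + 1, by omega⟩)
        (Function.update w i x ⟨2 * (k : ℕ) + 2, by omega⟩) = L x := by
  let f (j : Fin (2 * n + 1)) (l : Fin n) (x : E) : ℝ :=
    b (Function.update w j x ⟨2 * (l : ℕ) + 1, by omega⟩)
      (Function.update w j x ⟨2 * (l : ℕ) + 2, by omega⟩)
  rcases fin_eq_zero_or_odd_or_even i with rfl | ⟨k, rfl⟩ | ⟨k, rfl⟩
  · refine ⟨(∏ k : Fin n, b (w ⟨2 * (k : ℕ) + 1, by omega⟩) (w ⟨2 * (k : ℕ) + 2, by omega⟩)) • a,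
      fun x => ?_⟩
    simp [Fin.ext_iff, mul_comm]
  · have hconst : ∀ l ≠ k, ∀ x, f ⟨2 * (k : ℕ) + 1, by omega⟩ l x =
        f ⟨2 * (k : ℕ) + 1, by omega⟩ l 0 := by
      intro l hl x
      have hlk : (l : ℕ) ≠ k := Fin.val_ne_of_ne hl
      have hparity : 2 * (l : ℕ) + 1 ≠ 2 * (k : ℕ) := by omega
      simp [f, Function.update_apply, Fin.ext_iff, hlk, hparity]
    obtain ⟨L, hL⟩ := exists_linearMap_eq_prod (f := f ⟨2 * (k : ℕ) + 1, by omega⟩)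
      (L := b.flip (w ⟨2 * (k : ℕ) + 2, by omega⟩)) (fun x => by simp [f]) hconst
    exact ⟨a (w 0) • L, fun x => by simp [← hL, f, Fin.ext_iff]⟩
  · have hconst : ∀ l ≠ k, ∀ x, f ⟨2 * (k : ℕ) + 2, by omega⟩ l x =
        f ⟨2 * (k : ℕ) + 2, by omega⟩ l 0 := by
      intro l hl x
      have hlk : (l : ℕ) ≠ k := Fin.val_ne_of_ne hl
      have hparity : 2 * (l : ℕ) ≠ 2 * (k : ℕ) + 1 := by omega
      simp [f, Function.update_apply, Fin.ext_iff, hlk, hparity]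
    obtain ⟨L, hL⟩ := exists_linearMap_eq_prod (f := f ⟨2 * (k : ℕ) + 2, by omega⟩)
      (L := b (w ⟨2 * (k : ℕ) + 1, by omega⟩)) (fun x => by simp [f]) hconst
    exact ⟨a (w 0) • L, fun x => by simp [← hL, f, Fin.ext_iff]⟩

/-- The multilinear map `a(v₀) b(v₁, v₂) ⋯ b(v₂ₙ₋₁, v₂ₙ)`, whose alternatization is
`wedgePow`. -/
noncomputable def wedgeTerm (n : ℕ) (a : E →ₗ[ℝ] ℝ) (b : E →ₗ[ℝ] E →ₗ[ℝ] ℝ) :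
    MultilinearMap ℝ (fun _ : Fin (2 * n + 1) => E) ℝ where
  toFun w := a (w 0) *
    ∏ k : Fin n, b (w ⟨2 * (k : ℕ) + 1, by omega⟩) (w ⟨2 * (k : ℕ) + 2, by omega⟩)
  map_update_add' w i x y := by
    obtain ⟨L, hL⟩ := exists_linearMap_eq_wedge_update a b w i
    rw [hL, hL, hL, map_add]
  map_update_smul' w i c x := by
    obtain ⟨L, hL⟩ := exists_linearMap_eq_wedge_update a b w i
    rw [hL, hL, map_smul]

theorem wedgePow_eq_alternatization {n : ℕ} (a : E →ₗ[ℝ] ℝ) (b : E →ₗ[ℝ] E →ₗ[ℝ] ℝ)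
    (w : Fin (2 * n + 1) → E) : wedgePow n a (fun u v => b u v) w =
      MultilinearMap.alternatization (wedgeTerm n a b) w := by
  rw [MultilinearMap.alternatization_apply]
  refine Finset.sum_congr rfl fun σ _ => ?_
  rw [Units.smul_def, zsmul_eq_mul]
  rfl

theorem exists_basis_fin_apply_eq {d : ℕ} [FiniteDimensional ℝ E] (hd : Module.finrank ℝ E = d)
    {v : E} (hv : v ≠ 0) : ∃ e : Module.Basis (Fin d) ℝ E, ∃ j, e j = v := by
  have hli : LinearIndepOn ℝ id {v} := .singleton hv
  have := FiniteDimensional.fintypeBasisIndex (Module.Basis.extend hli)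
  let eq := Fintype.equivFinOfCardEq
    ((Module.finrank_eq_card_basis (Module.Basis.extend hli)).symm.trans hd)
  exact ⟨(Module.Basis.extend hli).reindex eq,
    eq ⟨v, hli.subset_extend _ (mem_singleton v)⟩, by simp⟩

theorem exists_basis_fin_succ_of_mem_ker {d : ℕ} (hd : Module.finrank ℝ E = d + 1)
    {a : E →ₗ[ℝ] ℝ} (ha : a ≠ 0) {v : E} (hv : v ≠ 0) (hav : a v = 0) :
    ∃ e : Module.Basis (Fin (d + 1)) ℝ E, (∀ i, i ≠ 0 → a (e i) = 0) ∧ ∃ j ≠ 0, e j = v := by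
  have : FiniteDimensional ℝ E := Module.finite_of_finrank_pos (by omega)
  obtain ⟨r, hr⟩ : ∃ r, a r ≠ 0 := DFunLike.ne_iff.1 ha
  have hker : Module.finrank ℝ (LinearMap.ker a) = d := by
    have := Module.Dual.finrank_ker_add_one_of_ne_zero ha
    omega
  obtain ⟨bk, j, hj⟩ := exists_basis_fin_apply_eq hker (v := ⟨v, hav⟩)
    fun h => hv (congrArg Subtype.val h)
  let e := Module.Basis.mkFinCons r bk
    (fun c x hx hc => by
      have hac := congrArg a hc
      simp only [map_add, map_smul, LinearMap.mem_ker.1 hx, map_zero, add_zero, smul_eq_mul,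
        mul_eq_zero] at hac
      exact hac.resolve_right hr)
    (fun z => ⟨-(a z / a r), by simp [LinearMap.mem_ker, hr]⟩)
  refine ⟨e, fun i hi => ?_, j.succ, Fin.succ_ne_zero _, by simp [e, hj]⟩
  obtain ⟨k, rfl⟩ := Fin.exists_succ_eq.2 hi
  simp [e]

theorem prod_apply_eq_zero_of_apply_eq {n : ℕ} {b : E →ₗ[ℝ] E →ₗ[ℝ] ℝ} (hb : ∀ u v, b u v = -b v u)
    {w : Fin (2 * n + 1) → E} {v : E} (hv : ∀ k ≠ 0, b v (w k) = 0) {m : Fin (2 * n + 1)}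
    (hm : m ≠ 0) (hwm : w m = v) :
    ∏ i : Fin n, b (w ⟨2 * (i : ℕ) + 1, by omega⟩) (w ⟨2 * (i : ℕ) + 2, by omega⟩) = 0 := by
  rcases fin_eq_zero_or_odd_or_even m with rfl | ⟨k, rfl⟩ | ⟨k, rfl⟩
  · exact absurd rfl hm
  · refine Finset.prod_eq_zero (Finset.mem_univ k) ?_
    rw [hwm, hv _ (by simp [Fin.ext_iff])]
  · refine Finset.prod_eq_zero (Finset.mem_univ k) ?_
    rw [hwm, hb, hv _ (by simp [Fin.ext_iff]), neg_zero]

/- If `b(v, ·)` vanished on `ker a`, then `a ∧ bⁿ` would vanish on a basis made of `v`, of other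
vectors of `ker a` and of one vector out of `ker a`. -/
theorem exists_apply_ne_zero_of_wedgePow_ne_zero {n : ℕ} (hd : Module.finrank ℝ E = 2 * n + 1)
    {a : E →ₗ[ℝ] ℝ} {b : E →ₗ[ℝ] E →ₗ[ℝ] ℝ} (hb : ∀ u v, b u v = -b v u)
    {w : Fin (2 * n + 1) → E} (hw : wedgePow n a (fun u v => b u v) w ≠ 0) {v : E} (hv : v ≠ 0)
    (hav : a v = 0) : ∃ u, a u = 0 ∧ b v u ≠ 0 := by
  by_contra! hbv
  have ha : a ≠ 0 := by
    rintro rfl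
    exact hw (by simp [wedgePow])
  obtain ⟨e, he, j, hj0, hj⟩ := exists_basis_fin_succ_of_mem_ker hd ha hv hav
  suffices halt : MultilinearMap.alternatization (wedgeTerm n a b) = 0 from
    hw (by rw [wedgePow_eq_alternatization, halt]; rfl)
  refine Module.Basis.ext_alternating e fun τ hτ => ?_
  rw [← wedgePow_eq_alternatization]
  refine Finset.sum_eq_zero fun σ _ => mul_eq_zero_of_right _ ?_
  have hinj : Function.Injective (τ ∘ σ) := hτ.comp σ.injective
  rcases ne_or_eq (τ (σ 0)) 0 with h0 | h0
  · exact mul_eq_zero_of_left (he _ h0) _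
  obtain ⟨m, hm⟩ := Finite.injective_iff_surjective.1 hinj j
  refine mul_eq_zero_of_right _ (prod_apply_eq_zero_of_apply_eq hb (w := fun i => e (τ (σ i)))
    (fun k hk => hbv _ (he _ fun h => hk (hinj (h.trans h0.symm)))) (m := m) ?_ ?_)
  · rintro rfl
    exact hj0 (hm.symm.trans h0)
  · exact (congrArg e hm).trans hj

end Wedge

section Frame

variable {E : Type*} [NormedAddCommGroup E] [NormedSpace ℝ E]

theorem contDiffOn_matrix_det {m : ℕ} {k : WithTop ℕ∞} {s : Set E}
    {M : E → Matrix (Fin m) (Fin m) ℝ} (hM : ∀ i j, ContDiffOn ℝ k (fun x => M x i j) s) :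
    ContDiffOn ℝ k (fun x => (M x).det) s := by
  simp only [Matrix.det_apply']
  exact ContDiffOn.sum fun σ _ => contDiffOn_const.mul (contDiffOn_prod fun i _ => hM _ _)

theorem contDiffOn_matrix_inv_apply {m : ℕ} {k : WithTop ℕ∞} {s : Set E}
    {M : E → Matrix (Fin m) (Fin m) ℝ} (hM : ∀ i j, ContDiffOn ℝ k (fun x => M x i j) s)
    (hdet : ∀ x ∈ s, (M x).det ≠ 0) (i j : Fin m) :
    ContDiffOn ℝ k (fun x => (M x)⁻¹ i j) s := by
  simp only [Matrix.inv_def, Matrix.smul_apply, Matrix.adjugate_apply, Ring.inverse_eq_inv',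
    smul_eq_mul]
  refine ((contDiffOn_matrix_det hM).inv hdet).mul (contDiffOn_matrix_det fun a b => ?_)
  by_cases h : a = j
  · subst h
    simpa [Matrix.updateRow_apply] using contDiffOn_const
  · simpa [Matrix.updateRow_apply, h] using hM a b

/-- The cometric `η ↦ ∑ cᵢⱼ η(Xᵢ) Xⱼ`: the cometric of the inner product on the span of the frame
`X` whose Gram matrix is the inverse of `c`. -/
noncomputable def frameCometric {m : ℕ} (c : Matrix (Fin m) (Fin m) ℝ) (X : Fin m → E) :
    (E →L[ℝ] ℝ) →L[ℝ] E :=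
  ∑ i, ∑ j, c i j • (ContinuousLinearMap.apply ℝ ℝ (X i)).smulRight (X j)

variable {m : ℕ} {c : Matrix (Fin m) (Fin m) ℝ} {X : Fin m → E}

theorem frameCometric_apply (η : E →L[ℝ] ℝ) :
    frameCometric c X η = ∑ i, ∑ j, (c i j * η (X i)) • X j := by
  simp [frameCometric, smul_smul]

theorem apply_frameCometric (η ζ : E →L[ℝ] ℝ) :
    ζ (frameCometric c X η) = ∑ i, ∑ j, c i j * η (X i) * ζ (X j) := by
  simp [frameCometric_apply]

theorem frameCometric_symm (hc : c.PosDef) (η ζ : E →L[ℝ] ℝ) :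
    η (frameCometric c X ζ) = ζ (frameCometric c X η) := by
  rw [apply_frameCometric, apply_frameCometric, Finset.sum_comm]
  refine Finset.sum_congr rfl fun i _ => Finset.sum_congr rfl fun j _ => ?_
  have hsymm : c j i = c i j := by simpa using hc.isHermitian.apply i j
  rw [hsymm]
  ring

theorem frameCometric_nonneg (hc : c.PosDef) (η : E →L[ℝ] ℝ) :
    0 ≤ η (frameCometric c X η) := by
  rw [apply_frameCometric]
  refine (hc.posSemidef.dotProduct_mulVec_nonneg fun i => η (X i)).trans_eq ?_
  simp only [dotProduct, Matrix.mulVec, Finset.mul_sum, Pi.star_apply, star_trivial]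
  exact Finset.sum_congr rfl fun i _ => Finset.sum_congr rfl fun j _ => by ring

theorem frameCometric_eq_zero_iff (hc : c.PosDef) (hX : LinearIndependent ℝ X)
    (η : E →L[ℝ] ℝ) : frameCometric c X η = 0 ↔ ∀ i, η (X i) = 0 := by
  refine ⟨fun h => ?_, fun h => by simp [frameCometric_apply, h]⟩
  rw [frameCometric_apply, Finset.sum_comm] at h
  simp only [← Finset.sum_smul] at h
  have hcoeff := Fintype.linearIndependent_iff.1 hX _ h
  have hvec : Matrix.vecMul (fun i => η (X i)) c = 0 := by
    ext j
    simpa [Matrix.vecMul, dotProduct, mul_comm] using hcoeff j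
  exact congrFun (Matrix.vecMul_injective_iff_isUnit.2 hc.isUnit
    (hvec.trans (Matrix.zero_vecMul c).symm))

theorem contDiffOn_frameCometric {s : Set E} {k : WithTop ℕ∞}
    {c : E → Matrix (Fin m) (Fin m) ℝ} {X : Fin m → E → E}
    (hc : ∀ i j, ContDiffOn ℝ k (fun x => c x i j) s) (hX : ∀ i, ContDiffOn ℝ k (X i) s) :
    ContDiffOn ℝ k (fun x => frameCometric (c x) fun i => X i x) s := by
  unfold frameCometric
  refine ContDiffOn.sum fun i _ => ContDiffOn.sum fun j _ => (hc i j).smul ?_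
  exact ((ContinuousLinearMap.contDiff (ContinuousLinearMap.apply ℝ ℝ)).comp_contDiffOn
    (hX i)).smulRight (hX j)

end Frame

section ChartDeriv

variable {n : ℕ} {M : Type*} [TopologicalSpace M] [ChartedSpace (ContactModel n) M]

local notation "φ" => extChartAt (𝓡 (2 * n + 1))

/-- The derivative at `q` of the chart around `c`, as an endomorphism of the model space, with
which every tangent space is definitionally identified. -/
noncomputable def chartDeriv (c q : M) : ContactModel n →L[ℝ] ContactModel n :=
  mfderiv (𝓡 (2 * n + 1)) 𝓘(ℝ, ContactModel n) (φ c) q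

/-- The derivative at `x` of the inverse of the chart around `c`, as an endomorphism of the model
space. -/
noncomputable def chartSymmDeriv (c : M) (x : ContactModel n) :
    ContactModel n →L[ℝ] ContactModel n :=
  mfderiv 𝓘(ℝ, ContactModel n) (𝓡 (2 * n + 1)) (φ c).symm x

theorem exists_dOneForm_ne_zero_of_isContactFormAt {θ : ∀ q : M, CotSpace n q} {q : M}
    (hθ : IsContactFormAt θ q) {v : ContactModel n} (hv : v ≠ 0)
    (hθv : oneFormInChart θ q (φ q q) v = 0) :
    ∃ u, oneFormInChart θ q (φ q q) u = 0 ∧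
      dOneForm (oneFormInChart θ q) (φ q q) v u ≠ 0 := by
  obtain ⟨w, hw⟩ := hθ
  let D := fderiv ℝ (oneFormInChart θ q) (φ q q)
  let b : ContactModel n →ₗ[ℝ] ContactModel n →ₗ[ℝ] ℝ := D.toLinearMap₁₂ - D.toLinearMap₁₂.flip
  exact exists_apply_ne_zero_of_wedgePow_ne_zero finrank_euclideanSpace_fin
    (a := (oneFormInChart θ q (φ q q) : ContactModel n →ₗ[ℝ] ℝ)) (b := b)
    (fun u v => (neg_sub _ _).symm) hw hv hθv

variable [IsManifold (𝓡 (2 * n + 1)) ∞ M]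

theorem isManifold_one_of_infty : IsManifold (𝓡 (2 * n + 1)) 1 M :=
  IsManifold.of_le (n := ∞) (by simp)

theorem mdifferentiableAt_extChartAt_symm_of_mem_target {c : M} {x : ContactModel n}
    (hx : x ∈ (φ c).target) :
    MDifferentiableAt 𝓘(ℝ, ContactModel n) (𝓡 (2 * n + 1)) (φ c).symm x :=
  have := isManifold_one_of_infty (n := n) (M := M)
  (mdifferentiableOn_extChartAt_symm x hx).mdifferentiableAt
    ((isOpen_extChartAt_target c).mem_nhds hx)

theorem mdifferentiableAt_extChartAt_of_mem_source {c q : M} (hq : q ∈ (φ c).source) :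
    MDifferentiableAt (𝓡 (2 * n + 1)) 𝓘(ℝ, ContactModel n) (φ c) q :=
  have := isManifold_one_of_infty (n := n) (M := M)
  mdifferentiableAt_extChartAt (by simpa using hq)

theorem hasFDerivAt_transition {c c' : M} {x : ContactModel n} (hx : x ∈ (φ c).target)
    (hx' : (φ c).symm x ∈ (φ c').source) :
    HasFDerivAt (φ c' ∘ (φ c).symm)
      ((chartDeriv c' ((φ c).symm x)).comp (chartSymmDeriv c x)) x :=
  ((mdifferentiableAt_extChartAt_of_mem_source hx').hasMFDerivAt.comp x
    (mdifferentiableAt_extChartAt_symm_of_mem_target hx).hasMFDerivAt).hasFDerivAt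

theorem chartDeriv_comp_chartSymmDeriv {c : M} {x : ContactModel n} (hx : x ∈ (φ c).target) :
    (chartDeriv c ((φ c).symm x)).comp (chartSymmDeriv c x) =
      ContinuousLinearMap.id ℝ (ContactModel n) := by
  refine (hasFDerivAt_transition hx ((φ c).map_target hx)).unique
    ((hasFDerivAt_id x).congr_of_eventuallyEq ?_)
  filter_upwards [(isOpen_extChartAt_target c).mem_nhds hx] with y hy using (φ c).right_inv hy

theorem chartSymmDeriv_comp_chartDeriv {c : M} {x : ContactModel n} (hx : x ∈ (φ c).target) :
    (chartSymmDeriv c x).comp (chartDeriv c ((φ c).symm x)) =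
      ContinuousLinearMap.id ℝ (ContactModel n) := by
  have hmul : (chartDeriv (n := n) c ((φ c).symm x) : ContactModel n →ₗ[ℝ] ContactModel n) *
      (chartSymmDeriv (n := n) c x : ContactModel n →ₗ[ℝ] ContactModel n) = 1 := by
    ext1 v
    exact DFunLike.congr_fun (chartDeriv_comp_chartSymmDeriv hx) v
  ext1 v
  exact DFunLike.congr_fun (mul_eq_one_comm.1 hmul) v

theorem contDiffOn_vectorField_inChart {U : Set M} (hU : IsOpen U)
    {Y : ∀ q : M, TangentSpace (𝓡 (2 * n + 1)) q}
    (hY : ContMDiffOn (𝓡 (2 * n + 1)) (𝓡 (2 * n + 1)).tangent ∞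
      (fun q : M => (⟨q, Y q⟩ : TangentBundle (𝓡 (2 * n + 1)) M)) U) (c : M) :
    ContDiffOn ℝ ∞ (fun x => chartDeriv c ((φ c).symm x) (Y ((φ c).symm x)))
      ((φ c).target ∩ (φ c).symm ⁻¹' U) := by
  have := isManifold_one_of_infty (n := n) (M := M)
  have htriv := ((trivializationAt (ContactModel n) (TangentSpace (𝓡 (2 * n + 1))) c
    ).contMDiffOn_section_iff (IB := 𝓡 (2 * n + 1)) (n := ∞) (s := Y)
    (a := U ∩ (chartAt (ContactModel n) c).source)
    (hU.inter (chartAt (ContactModel n) c).open_source) (by simp)).1 (hY.mono inter_subset_left)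
  have hchart : ContMDiffOn (𝓡 (2 * n + 1)) 𝓘(ℝ, ContactModel n) ∞
      (fun q => chartDeriv c q (Y q)) (U ∩ (chartAt (ContactModel n) c).source) := by
    refine htriv.congr fun q hq => ?_
    refine (congrArg (fun L => L (Y q)) (TangentBundle.continuousLinearMapAt_trivializationAt
      (𝕜 := ℝ) (I := 𝓡 (2 * n + 1)) hq.2)).symm.trans ?_
    rw [Bundle.Trivialization.continuousLinearMapAt_apply_of_mem]
    simpa using hq.2
  rw [← contMDiffOn_iff_contDiffOn]
  refine hchart.comp ((contMDiffOn_extChartAt_symm c).mono inter_subset_left)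
    fun x hx => ⟨hx.2, ?_⟩
  simpa using (φ c).map_target hx.1

theorem contDiffOn_function_inChart {U : Set M} {f : M → ℝ}
    (hf : ContMDiffOn (𝓡 (2 * n + 1)) 𝓘(ℝ, ℝ) ∞ f U) (c : M) :
    ContDiffOn ℝ ∞ (fun x => f ((φ c).symm x)) ((φ c).target ∩ (φ c).symm ⁻¹' U) := by
  rw [← contMDiffOn_iff_contDiffOn]
  exact hf.comp ((contMDiffOn_extChartAt_symm c).mono inter_subset_left) fun x hx => hx.2

theorem oneFormInChart_chartDeriv (θ : ∀ q : M, CotSpace n q) {c : M} {x : ContactModel n}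
    (hx : x ∈ (φ c).target) (v : TangentSpace (𝓡 (2 * n + 1)) ((φ c).symm x)) :
    oneFormInChart θ c x (chartDeriv c ((φ c).symm x) v) = θ ((φ c).symm x) v :=
  congrArg (θ ((φ c).symm x)) (DFunLike.congr_fun (chartSymmDeriv_comp_chartDeriv hx) v)

end ChartDeriv

theorem exists_smul_eq_iff_forall_apply_eq_zero {E : Type*} [NormedAddCommGroup E]
    [NormedSpace ℝ E] {θ η : E →L[ℝ] ℝ} :
    (∃ f : ℝ, f • θ = η) ↔ ∀ u, θ u = 0 → η u = 0 := by
  refine ⟨?_, fun h => ?_⟩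
  · rintro ⟨f, rfl⟩ u hu
    simp [hu]
  · have hmem : (η : E →ₗ[ℝ] ℝ) ∈ Submodule.span ℝ (range fun _ : Unit => (θ : E →ₗ[ℝ] ℝ)) :=
      mem_span_of_iInf_ker_le_ker fun u hu => h u (by simpa using hu)
    rw [range_const, Submodule.mem_span_singleton] at hmem
    obtain ⟨f, hf⟩ := hmem
    exact ⟨f, ContinuousLinearMap.coe_injective hf⟩

namespace ContactSubRiemannian

variable {n : ℕ} {M : Type*} [TopologicalSpace M] [ChartedSpace (ContactModel n) M]
  [IsManifold (𝓡 (2 * n + 1)) ∞ M]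

local notation "φ" => extChartAt (𝓡 (2 * n + 1))

theorem g_nonneg (S : ContactSubRiemannian n M) (q : M) (v : S.Δ q) : 0 ≤ S.g q v v := by
  by_cases hv : v = 0
  · simp [hv]
  · exact (S.g_pos q v hv).le

theorem hamiltonian_eq_of_represents (S : ContactSubRiemannian n M) {q : M} {p : CotSpace n q}
    {b : S.Δ q} (hb : ∀ v : S.Δ q, S.g q b v = p v) : S.hamiltonian q p = 1 / 2 * p b := by
  unfold hamiltonian
  congr 1
  have hle : ∀ v : {v : S.Δ q // v ≠ 0}, p (v : S.Δ q) ^ 2 / S.g q v v ≤ p b := fun v => by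
    have hcs := LinearMap.BilinForm.apply_mul_apply_le_of_forall_zero_le (S.g q) (S.g_nonneg q) b v
    rw [S.g_symm q v b, hb, hb] at hcs
    rwa [div_le_iff₀ (S.g_pos q v v.2), sq]
  by_cases hb0 : b = 0
  · have hp0 : ∀ v : S.Δ q, p v = 0 := fun v => by rw [← hb, hb0]; simp
    simp [hp0]
  · have : Nonempty {v : S.Δ q // v ≠ 0} := ⟨⟨b, hb0⟩⟩
    refine le_antisymm (ciSup_le hle) ?_
    refine le_ciSup_of_le ⟨p b, by rintro _ ⟨v, rfl⟩; exact hle v⟩ ⟨b, hb0⟩ ?_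
    have hpos : 0 < p b := by rw [← hb]; exact S.g_pos q b hb0
    simp only [hb]
    rw [sq, mul_div_assoc, div_self hpos.ne', mul_one]

/-- The Gram matrix of a frame of the distribution. -/
noncomputable def gram (S : ContactSubRiemannian n M) {m : ℕ} (q : M) (Y : Fin m → S.Δ q) :
    Matrix (Fin m) (Fin m) ℝ :=
  Matrix.of fun i j => S.g q (Y i) (Y j)

theorem posDef_gram (S : ContactSubRiemannian n M) {m : ℕ} {q : M} {Y : Fin m → S.Δ q}
    (hY : LinearIndependent ℝ Y) : (S.gram q Y).PosDef := by
  refine Matrix.PosDef.of_dotProduct_mulVec_pos (Matrix.IsHermitian.ext fun i j => ?_) ?_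
  · simp [gram, S.g_symm q (Y j) (Y i)]
  · intro a ha
    have hne : ∑ i, a i • Y i ≠ 0 := fun h =>
      ha (funext (Fintype.linearIndependent_iff.1 hY a h))
    refine (S.g_pos q _ hne).trans_eq ?_
    simp only [map_sum, map_smul, LinearMap.sum_apply, LinearMap.smul_apply, smul_eq_mul,
      dotProduct, Matrix.mulVec, gram, Finset.mul_sum, Pi.star_apply, star_trivial,
      Matrix.of_apply]
    rw [Finset.sum_comm]
    exact Finset.sum_congr rfl fun i _ => Finset.sum_congr rfl fun j _ => by ring

theorem hamiltonian_eq_frame (S : ContactSubRiemannian n M) {m : ℕ} {q : M} {Y : Fin m → S.Δ q}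
    (hY : LinearIndependent ℝ Y) (hspan : Submodule.span ℝ (range Y) = ⊤) (p : CotSpace n q) :
    S.hamiltonian q p = 1 / 2 * ∑ i, ∑ j, (S.gram q Y)⁻¹ i j * p (Y i) * p (Y j) := by
  have hunit : IsUnit (S.gram q Y).det :=
    (Matrix.isUnit_iff_isUnit_det _).1 (S.posDef_gram hY).isUnit
  let b : S.Δ q := ∑ i, ∑ j, ((S.gram q Y)⁻¹ i j * p (Y i)) • Y j
  have hb : ∀ v : S.Δ q, S.g q b v = p v := by
    suffices h : S.g q b = (p : _ →ₗ[ℝ] ℝ).comp (S.Δ q).subtype from fun v => by rw [h]; rfl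
    refine LinearMap.ext_on_range hspan fun k => ?_
    have hinv : ∀ i, ∑ j, (S.gram q Y)⁻¹ i j * S.g q (Y j) (Y k) = if i = k then 1 else 0 := by
      intro i
      rw [← Matrix.one_apply, ← Matrix.nonsing_inv_mul _ hunit, Matrix.mul_apply]
      rfl
    calc S.g q b (Y k) = ∑ i, p (Y i) * ∑ j, (S.gram q Y)⁻¹ i j * S.g q (Y j) (Y k) := by
          simp only [b, map_sum, map_smul, LinearMap.sum_apply, LinearMap.smul_apply,
            smul_eq_mul, Finset.mul_sum]
          exact Finset.sum_congr rfl fun i _ => Finset.sum_congr rfl fun j _ => by ring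
      _ = p (Y k) := by simp [hinv]
  rw [S.hamiltonian_eq_of_represents hb]
  simp [b]

/-- The distribution at `q`, read in the chart around `c`. -/
noncomputable def distribInChart (S : ContactSubRiemannian n M) (c q : M) :
    S.Δ q →ₗ[ℝ] ContactModel n where
  toFun v := chartDeriv c q v.1
  map_add' v w := (chartDeriv c q).map_add v.1 w.1
  map_smul' a v := (chartDeriv c q).map_smul a v.1

section

variable (S : ContactSubRiemannian n M) {c : M} {x : ContactModel n}

theorem distribInChart_injective (hx : x ∈ (φ c).target) :
    Function.Injective (S.distribInChart c ((φ c).symm x)) := fun v w h =>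
  Subtype.ext <| (DFunLike.congr_fun (chartSymmDeriv_comp_chartDeriv hx) v.1).symm.trans <|
    (congrArg (chartSymmDeriv c x) h).trans
      (DFunLike.congr_fun (chartSymmDeriv_comp_chartDeriv hx) w.1)

theorem range_distribInChart {θ : ∀ q : M, CotSpace n q} (hx : x ∈ (φ c).target)
    (hθ : ∀ v, v ∈ S.Δ ((φ c).symm x) ↔ θ ((φ c).symm x) v = 0) {u : ContactModel n} :
    u ∈ range (S.distribInChart c ((φ c).symm x)) ↔ oneFormInChart θ c x u = 0 := by
  refine ⟨?_, fun hu => ⟨⟨chartSymmDeriv c x u, (hθ _).2 hu⟩,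
    DFunLike.congr_fun (chartDeriv_comp_chartSymmDeriv (n := n) hx) u⟩⟩
  rintro ⟨v, rfl⟩
  exact (oneFormInChart_chartDeriv θ hx v.1).trans ((hθ v.1).1 v.2)

/-- The cometric of the structure, read in the chart around `c` by means of the frame `Y` of the
distribution. -/
noncomputable def cometricInChart {m : ℕ} (Y : Fin m → ∀ q : M, S.Δ q) (c : M)
    (x : ContactModel n) : (ContactModel n →L[ℝ] ℝ) →L[ℝ] ContactModel n :=
  frameCometric (S.gram ((φ c).symm x) fun i => Y i ((φ c).symm x))⁻¹
    fun i => S.distribInChart c ((φ c).symm x) (Y i ((φ c).symm x))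

variable {m : ℕ} {Y : Fin m → ∀ q : M, S.Δ q}

theorem cometricInChart_eq_zero_iff {θ : ∀ q : M, CotSpace n q} (hx : x ∈ (φ c).target)
    (hθ : ∀ v, v ∈ S.Δ ((φ c).symm x) ↔ θ ((φ c).symm x) v = 0)
    (hY : LinearIndependent ℝ fun i => Y i ((φ c).symm x))
    (hspan : Submodule.span ℝ (range fun i => Y i ((φ c).symm x)) = ⊤)
    (η : ContactModel n →L[ℝ] ℝ) :
    S.cometricInChart Y c x η = 0 ↔ ∃ f : ℝ, f • oneFormInChart θ c x = η := by
  have hX := hY.map' _ (LinearMap.ker_eq_bot.2 (S.distribInChart_injective hx))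
  rw [exists_smul_eq_iff_forall_apply_eq_zero]
  refine (frameCometric_eq_zero_iff (S.posDef_gram hY).inv hX η).trans ⟨fun h u hu => ?_,
    fun h i => h _ ((S.range_distribInChart hx hθ).1 (mem_range_self _))⟩
  obtain ⟨v, rfl⟩ := (S.range_distribInChart hx hθ).2 hu
  exact DFunLike.congr_fun (LinearMap.ext_on_range hspan h :
    (η : ContactModel n →ₗ[ℝ] ℝ).comp (S.distribInChart c _) = 0) v

theorem contDiffOn_cometricInChart {U : Set M} (hU : IsOpen U)
    (hYs : ∀ i, ContMDiffOn (𝓡 (2 * n + 1)) (𝓡 (2 * n + 1)).tangent ∞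
      (fun q : M => (⟨q, (Y i q : TangentSpace (𝓡 (2 * n + 1)) q)⟩ :
        TangentBundle (𝓡 (2 * n + 1)) M)) U)
    (hYg : ∀ i j, ContMDiffOn (𝓡 (2 * n + 1)) 𝓘(ℝ, ℝ) ∞ (fun q : M => S.g q (Y i q) (Y j q)) U)
    (hYb : ∀ q ∈ U, LinearIndependent ℝ fun i => Y i q) (c : M) :
    ContDiffOn ℝ ∞ (S.cometricInChart Y c) ((φ c).target ∩ (φ c).symm ⁻¹' U) :=
  contDiffOn_frameCometric (contDiffOn_matrix_inv_apply
      (M := fun x => S.gram ((φ c).symm x) fun i => Y i ((φ c).symm x))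
      (fun i j => contDiffOn_function_inChart (hYg i j) c)
      fun _ hx => (S.posDef_gram (hYb _ hx.2)).det_pos.ne')
    fun i => contDiffOn_vectorField_inChart hU (hYs i) c

theorem hamiltonianInChart_eq_cometricInChart
    (hY : LinearIndependent ℝ fun i => Y i ((φ c).symm x))
    (hspan : Submodule.span ℝ (range fun i => Y i ((φ c).symm x)) = ⊤)
    (ξ : ContactModel n →L[ℝ] ℝ) :
    S.hamiltonianInChart c x ξ = 1 / 2 * ξ (S.cometricInChart Y c x ξ) := by
  rw [cometricInChart, apply_frameCometric]
  exact S.hamiltonian_eq_frame hY hspan (covectorOfChart c x ξ)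

end

/-- `B` is the cometric of `S` in the chart around `q₀`, over a neighbourhood `Ω` of the point with
coordinates `φ q₀ q₀`, and `θ` is the expression in this chart of a local contact form of `S`. -/
structure IsCometricInChart (S : ContactSubRiemannian n M) (q₀ : M)
    (B : ContactModel n → (ContactModel n →L[ℝ] ℝ) →L[ℝ] ContactModel n)
    (θ : ContactModel n → ContactModel n →L[ℝ] ℝ) (Ω : Set (ContactModel n)) : Prop
    extends IsContactCometric B θ Ω (φ q₀ q₀) where
  subset_target : Ω ⊆ (φ q₀).target
  hamiltonianInChart_eq : ∀ x ∈ Ω, ∀ ξ, S.hamiltonianInChart q₀ x ξ = 1 / 2 * ξ (B x ξ)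
  mem_distribution_iff : ∀ v : TangentSpace (𝓡 (2 * n + 1)) q₀,
    v ∈ S.Δ q₀ ↔ θ (φ q₀ q₀) (chartDeriv q₀ q₀ v) = 0

theorem exists_isCometricInChart (S : ContactSubRiemannian n M) (q₀ : M) :
    ∃ B θ Ω, S.IsCometricInChart q₀ B θ Ω := by
  obtain ⟨U, hU, hqU, Y, hYs, hYb, hYg⟩ := S.smooth q₀
  obtain ⟨U', hU', hqU', θ, hθs, hθ⟩ := S.contact q₀
  have hopen : ∀ {V : Set M}, IsOpen V → IsOpen ((φ q₀).target ∩ (φ q₀).symm ⁻¹' V) :=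
    (continuousOn_extChartAt_symm q₀).isOpen_inter_preimage (isOpen_extChartAt_target q₀)
  have hx₀ : φ q₀ q₀ ∈ (φ q₀).target := mem_extChartAt_target q₀
  have hx₀V : ∀ {V : Set M}, q₀ ∈ V → φ q₀ q₀ ∈ (φ q₀).symm ⁻¹' V := fun hV => by
    rwa [mem_preimage, extChartAt_to_inv]
  refine ⟨S.cometricInChart Y q₀, oneFormInChart θ q₀,
    (φ q₀).target ∩ (φ q₀).symm ⁻¹' (U ∩ U'),
    { isOpen := hopen (hU.inter hU')
      mem := ⟨hx₀, hx₀V ⟨hqU, hqU'⟩⟩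
      contDiffOn := (S.contDiffOn_cometricInChart hU hYs hYg (fun q hq => (hYb q hq).1) q₀).mono
        fun x hx => ⟨hx.1, hx.2.1⟩
      symm := fun x hx => frameCometric_symm (S.posDef_gram (hYb _ hx.2.1).1).inv
      nonneg := fun x hx => frameCometric_nonneg (S.posDef_gram (hYb _ hx.2.1).1).inv
      apply_eq_zero_iff := fun x hx => S.cometricInChart_eq_zero_iff hx.1 (hθ _ hx.2.2).1
        (hYb _ hx.2.1).1 (hYb _ hx.2.1).2
      form_ne := fun h0 => ?_
      differentiableAt := ((hθs q₀).contDiffAt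
        ((hopen hU').mem_nhds ⟨hx₀, hx₀V hqU'⟩)).differentiableAt (by simp)
      nondegenerate := fun v hv hθv =>
        exists_dOneForm_ne_zero_of_isContactFormAt (hθ q₀ hqU').2 hv hθv
      subset_target := inter_subset_left
      hamiltonianInChart_eq := fun x hx => S.hamiltonianInChart_eq_cometricInChart
        (hYb _ hx.2.1).1 (hYb _ hx.2.1).2
      mem_distribution_iff := fun v => ?_ }⟩
  · obtain ⟨w, hw⟩ := (hθ q₀ hqU').2
    exact hw (by rw [h0]; simp [wedgePow])
  · rw [(hθ q₀ hqU').1 v]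
    have hθv := oneFormInChart_chartDeriv θ hx₀
    rw [extChartAt_to_inv] at hθv
    rw [hθv]

end ContactSubRiemannian

section ChangeOfCoordinates

variable {E : Type*} [NormedAddCommGroup E] [NormedSpace ℝ E]

/-- The linear form dual to `w` for the symplectic form of `E × E*`: the differential of a function
`H` at a point is `symplecticDual w` when `w = (∂H/∂ξ, -∂H/∂x)` is the value of the Hamiltonian
vector field of `H` there. -/
noncomputable def symplecticDual (w : E × (E →L[ℝ] ℝ)) : E × (E →L[ℝ] ℝ) →L[ℝ] ℝ :=
  (ContinuousLinearMap.apply ℝ ℝ w.1).comp (ContinuousLinearMap.snd ℝ E (E →L[ℝ] ℝ)) -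
    w.2.comp (ContinuousLinearMap.fst ℝ E (E →L[ℝ] ℝ))

theorem symplecticDual_apply (w z : E × (E →L[ℝ] ℝ)) :
    symplecticDual w z = z.2 w.1 - w.2 z.1 :=
  rfl

section

variable {H : E → (E →L[ℝ] ℝ) → ℝ} {w : E × (E →L[ℝ] ℝ)} {x : E} {ξ : E →L[ℝ] ℝ}

theorem fderiv_momentum_of_hasFDerivAt_symplecticDual
    (hH : HasFDerivAt (fun z : E × (E →L[ℝ] ℝ) => H z.1 z.2) (symplecticDual w) (x, ξ))
    (a : E →L[ℝ] ℝ) : fderiv ℝ (fun η => H x η) ξ a = a w.1 := by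
  have hpartial : HasFDerivAt (fun η => H x η) _ ξ :=
    HasFDerivAt.comp (f := fun η => (x, η)) ξ hH (hasFDerivAt_prodMk_right x ξ)
  simp [hpartial.fderiv, symplecticDual_apply]

theorem fderiv_position_of_hasFDerivAt_symplecticDual
    (hH : HasFDerivAt (fun z : E × (E →L[ℝ] ℝ) => H z.1 z.2) (symplecticDual w) (x, ξ))
    (u : E) : fderiv ℝ (fun y => H y ξ) x u = -w.2 u := by
  have hpartial : HasFDerivAt (fun y => H y ξ) _ x :=
    HasFDerivAt.comp (f := fun y => (y, ξ)) x hH (hasFDerivAt_prodMk_left x ξ)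
  simp [hpartial.fderiv, symplecticDual_apply]

end

theorem IsContactCometric.hasFDerivAt_hamiltonian {B : E → (E →L[ℝ] ℝ) →L[ℝ] E}
    {θ : E → E →L[ℝ] ℝ} {Ω : Set E} {x₀ : E} (h : IsContactCometric B θ Ω x₀)
    {H : E → (E →L[ℝ] ℝ) → ℝ} (hH : ∀ x ∈ Ω, ∀ ξ, H x ξ = 1 / 2 * ξ (B x ξ))
    {z : E × (E →L[ℝ] ℝ)} (hz : z.1 ∈ Ω) :
    HasFDerivAt (fun z : E × (E →L[ℝ] ℝ) => H z.1 z.2) (symplecticDual (cometricField B z)) z := by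
  have hB : HasFDerivAt (fun y : E × (E →L[ℝ] ℝ) => B y.1 y.2) _ z :=
    ((h.hasFDerivAt hz).comp z hasFDerivAt_fst).clm_apply hasFDerivAt_snd
  have hquad := (hasFDerivAt_snd.clm_apply hB).const_mul (1 / 2 : ℝ)
  have hHquad : (fun y : E × (E →L[ℝ] ℝ) => H y.1 y.2) =ᶠ[𝓝 z]
      fun y => 1 / 2 * y.2 (B y.1 y.2) := by
    filter_upwards [continuousAt_fst.preimage_mem_nhds (h.isOpen.mem_nhds hz)] with y hy
      using hH _ hy _
  refine (hquad.congr_of_eventuallyEq hHquad).congr_fderiv (ContinuousLinearMap.ext fun y => ?_)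
  have hsymm := h.symm z.1 hz z.2 y.2
  simp only [one_div, Function.comp_apply, ContinuousLinearMap.comp_add, smul_add, add_apply,
    smul_apply, ContinuousLinearMap.comp_apply, ContinuousLinearMap.coe_snd', hsymm, smul_eq_mul,
    ContinuousLinearMap.flip_apply, ContinuousLinearMap.coe_fst', cometricField, neg_smul,
    symplecticDual_apply, neg_apply, sub_neg_eq_add]
  ring

/-- `ψ` is a local change of coordinates of class `C²` at `x`, with local inverse `κ`. -/
structure IsChangeOfCoordinates (ψ κ : E → E) (x : E) : Prop where
  contDiffAt : ContDiffAt ℝ 2 ψ x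
  contDiffAt_symm : ContDiffAt ℝ 2 κ (ψ x)
  right_inv : ∀ᶠ y in 𝓝 (ψ x), ψ (κ y) = y
  left_inv : ∀ᶠ y in 𝓝 x, κ (ψ y) = y

namespace IsChangeOfCoordinates

variable {ψ κ : E → E} {x : E}

theorem symm_apply_apply (h : IsChangeOfCoordinates ψ κ x) : κ (ψ x) = x :=
  h.left_inv.self_of_nhds

theorem hasFDerivAt (h : IsChangeOfCoordinates ψ κ x) : HasFDerivAt ψ (fderiv ℝ ψ x) x :=
  (h.contDiffAt.differentiableAt (by simp)).hasFDerivAt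

theorem hasFDerivAt_symm (h : IsChangeOfCoordinates ψ κ x) :
    HasFDerivAt κ (fderiv ℝ κ (ψ x)) (ψ x) :=
  (h.contDiffAt_symm.differentiableAt (by simp)).hasFDerivAt

theorem hasFDerivAt_fderiv_symm (h : IsChangeOfCoordinates ψ κ x) :
    HasFDerivAt (fderiv ℝ κ) (fderiv ℝ (fderiv ℝ κ) (ψ x)) (ψ x) :=
  ((h.contDiffAt_symm.fderiv_right (m := 1) (by norm_num)).differentiableAt
    (by simp)).hasFDerivAt

theorem hasFDerivAt_fderiv_comp_symm (h : IsChangeOfCoordinates ψ κ x) :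
    HasFDerivAt (fun y => fderiv ℝ ψ (κ y))
      ((fderiv ℝ (fderiv ℝ ψ) x).comp (fderiv ℝ κ (ψ x))) (ψ x) := by
  have hψ : HasFDerivAt (fderiv ℝ ψ) (fderiv ℝ (fderiv ℝ ψ) x) (κ (ψ x)) := by
    rw [h.symm_apply_apply]
    exact ((h.contDiffAt.fderiv_right (m := 1) (by norm_num)).differentiableAt
      (by simp)).hasFDerivAt
  exact hψ.comp (ψ x) h.hasFDerivAt_symm

theorem fderiv_symm_apply_fderiv (h : IsChangeOfCoordinates ψ κ x) (w : E) :
    fderiv ℝ κ (ψ x) (fderiv ℝ ψ x w) = w :=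
  DFunLike.congr_fun ((h.hasFDerivAt_symm.comp x h.hasFDerivAt).unique
    ((hasFDerivAt_id x).congr_of_eventuallyEq h.left_inv)) w

theorem eventually_fderiv_comp_fderiv_symm (h : IsChangeOfCoordinates ψ κ x) :
    ∀ᶠ y in 𝓝 (ψ x), (fderiv ℝ ψ (κ y)).comp (fderiv ℝ κ y) = ContinuousLinearMap.id ℝ E := by
  have hκ : ∀ᶠ y in 𝓝 (ψ x), DifferentiableAt ℝ κ y :=
    (h.contDiffAt_symm.eventually (by simp)).mono fun y hy => hy.differentiableAt (by simp)
  have hψ : ∀ᶠ y in 𝓝 (κ (ψ x)), DifferentiableAt ℝ ψ y := by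
    rw [h.symm_apply_apply]
    exact (h.contDiffAt.eventually (by simp)).mono fun y hy => hy.differentiableAt (by simp)
  filter_upwards [hκ, h.hasFDerivAt_symm.continuousAt.eventually hψ, h.right_inv.eventually_nhds]
    with y hκy hψy hid
  exact (hψy.hasFDerivAt.comp y hκy.hasFDerivAt).unique
    ((hasFDerivAt_id y).congr_of_eventuallyEq hid)

theorem fderiv_symm_apply_second_fderiv (h : IsChangeOfCoordinates ψ κ x) (u v : E) :
    fderiv ℝ κ (ψ x) (fderiv ℝ (fderiv ℝ ψ) x (fderiv ℝ κ (ψ x) u) v) =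
      -fderiv ℝ (fderiv ℝ κ) (ψ x) (fderiv ℝ ψ x v) u := by
  have hderiv := (h.hasFDerivAt_fderiv_comp_symm.clm_comp h.hasFDerivAt_fderiv_symm).unique
    ((hasFDerivAt_const (ContinuousLinearMap.id ℝ E) (ψ x)).congr_of_eventuallyEq
      h.eventually_fderiv_comp_fderiv_symm)
  have happly := congrArg (fun T : E →L[ℝ] E →L[ℝ] E => fderiv ℝ κ (ψ x) (T u (fderiv ℝ ψ x v)))
    hderiv
  simp only [h.symm_apply_apply, add_apply, ContinuousLinearMap.comp_apply,
    ContinuousLinearMap.compL_apply, ContinuousLinearMap.flip_apply, zero_apply, map_add, map_zero,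
    h.fderiv_symm_apply_fderiv] at happly
  have hsymm : IsSymmSndFDerivAt ℝ κ (ψ x) :=
    h.contDiffAt_symm.isSymmSndFDerivAt (by simp [minSmoothness_of_isRCLikeNormedField])
  rw [hsymm (fderiv ℝ ψ x v) u]
  exact eq_neg_of_add_eq_zero_right happly

/- The map `(x, ξ) ↦ (ψ x, ξ ∘ ψ'(x)⁻¹)` of `E × E*` is symplectic, hence it sends the Hamiltonian
vector field of `H₀` to that of `H₁`. -/
theorem hasFDerivAt_hamiltonian (h : IsChangeOfCoordinates ψ κ x) {H₀ H₁ : E → (E →L[ℝ] ℝ) → ℝ}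
    (hH : ∀ᶠ y in 𝓝 (ψ x), ∀ η : E →L[ℝ] ℝ, H₁ y η = H₀ (κ y) (η.comp (fderiv ℝ ψ (κ y))))
    {ξ : E →L[ℝ] ℝ} {v : E} {α : E →L[ℝ] ℝ}
    (hH₀ : HasFDerivAt (fun z : E × (E →L[ℝ] ℝ) => H₀ z.1 z.2) (symplecticDual (v, α)) (x, ξ)) :
    HasFDerivAt (fun z : E × (E →L[ℝ] ℝ) => H₁ z.1 z.2)
      (symplecticDual (fderiv ℝ ψ x v, α.comp (fderiv ℝ κ (ψ x)) +
        ξ.comp (fderiv ℝ (fderiv ℝ κ) (ψ x) (fderiv ℝ ψ x v))))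
      (ψ x, ξ.comp (fderiv ℝ κ (ψ x))) := by
  set z : E × (E →L[ℝ] ℝ) := (ψ x, ξ.comp (fderiv ℝ κ (ψ x)))
  let F : E × (E →L[ℝ] ℝ) → E × (E →L[ℝ] ℝ) := fun y => (κ y.1, y.2.comp (fderiv ℝ ψ (κ y.1)))
  have hF : HasFDerivAt F _ z :=
    (h.hasFDerivAt_symm.comp z hasFDerivAt_fst).prodMk
      (hasFDerivAt_snd.clm_comp
        (h.hasFDerivAt_fderiv_comp_symm.comp (f := Prod.fst) z hasFDerivAt_fst))
  have hFz : F z = (x, ξ) := by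
    ext w
    · simp [F, z, h.symm_apply_apply]
    · simp [F, z, h.symm_apply_apply, h.fderiv_symm_apply_fderiv]
  rw [← hFz] at hH₀
  have hcomp : (fun y : E × (E →L[ℝ] ℝ) => H₁ y.1 y.2) =ᶠ[𝓝 z] fun y => H₀ (F y).1 (F y).2 :=
    (continuousAt_fst (p := z).eventually hH).mono fun y hy => hy y.2
  refine ((hH₀.comp z hF).congr_of_eventuallyEq hcomp).congr_fderiv
    (ContinuousLinearMap.ext fun y => ?_)
  simp only [h.symm_apply_apply, ContinuousLinearMap.comp_apply, ContinuousLinearMap.prod_apply,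
    ContinuousLinearMap.coe_fst', add_apply, ContinuousLinearMap.compL_apply,
    ContinuousLinearMap.coe_snd', ContinuousLinearMap.flip_apply, symplecticDual_apply,
    h.fderiv_symm_apply_second_fderiv, map_neg, z]
  ring

theorem hasDerivWithinAt_position {y : ℝ → E} {v : E} {I : Set ℝ} {t : ℝ}
    (h : IsChangeOfCoordinates ψ κ (y t)) (hy : HasDerivWithinAt y v I t) :
    HasDerivWithinAt (fun s => ψ (y s)) (fderiv ℝ ψ (y t) v) I t :=
  h.hasFDerivAt.comp_hasDerivWithinAt t hy

theorem hasDerivWithinAt_momentum {y : ℝ → E} {v : E} {η : ℝ → E →L[ℝ] ℝ} {α : E →L[ℝ] ℝ}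
    {I : Set ℝ} {t : ℝ} (h : IsChangeOfCoordinates ψ κ (y t)) (hy : HasDerivWithinAt y v I t)
    (hη : HasDerivWithinAt η α I t) :
    HasDerivWithinAt (fun s => (η s).comp (fderiv ℝ κ (ψ (y s))))
      (α.comp (fderiv ℝ κ (ψ (y t))) +
        (η t).comp (fderiv ℝ (fderiv ℝ κ) (ψ (y t)) (fderiv ℝ ψ (y t) v))) I t :=
  hη.clm_comp (h.hasFDerivAt_fderiv_symm.comp_hasDerivWithinAt t (h.hasDerivWithinAt_position hy))

end IsChangeOfCoordinates

end ChangeOfCoordinates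

section Transition

variable {n : ℕ} {M : Type*} [TopologicalSpace M] [ChartedSpace (ContactModel n) M]
  {c c' : M} {x : ContactModel n}

local notation "φ" => extChartAt (𝓡 (2 * n + 1))

theorem eventually_mem_transition (hx : x ∈ (φ c).target) (hx' : (φ c).symm x ∈ (φ c').source) :
    ∀ᶠ y in 𝓝 x, y ∈ (φ c).target ∧ (φ c).symm y ∈ (φ c').source :=
  ((isOpen_extChartAt_target c).eventually_mem hx).and
    ((continuousAt_extChartAt_symm'' hx).eventually_mem
      ((isOpen_extChartAt_source c').mem_nhds hx'))

theorem extChartAt_symm_transition (hx' : (φ c).symm x ∈ (φ c').source) :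
    (φ c').symm ((φ c' ∘ (φ c).symm) x) = (φ c).symm x :=
  (φ c').left_inv hx'

theorem mem_source_transition (hx : x ∈ (φ c).target) (hx' : (φ c).symm x ∈ (φ c').source) :
    (φ c').symm ((φ c' ∘ (φ c).symm) x) ∈ (φ c).source := by
  rw [extChartAt_symm_transition hx']
  exact (φ c).map_target hx

theorem eventually_transition_transition (hx : x ∈ (φ c).target)
    (hx' : (φ c).symm x ∈ (φ c').source) :
    ∀ᶠ y in 𝓝 x, (φ c ∘ (φ c').symm) ((φ c' ∘ (φ c).symm) y) = y := by
  filter_upwards [eventually_mem_transition hx hx'] with y hy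
  rw [Function.comp_apply, extChartAt_symm_transition hy.2, (φ c).right_inv hy.1]

variable [IsManifold (𝓡 (2 * n + 1)) ∞ M]

theorem contDiffAt_transition (hx : x ∈ (φ c).target) (hx' : (φ c).symm x ∈ (φ c').source) :
    ContDiffAt ℝ ∞ (φ c' ∘ (φ c).symm) x := by
  rw [← contMDiffAt_iff_contDiffAt]
  exact ContMDiffAt.comp x (contMDiffAt_extChartAt' (by simpa using hx'))
    ((contMDiffOn_extChartAt_symm c).contMDiffAt ((isOpen_extChartAt_target c).mem_nhds hx))

theorem isChangeOfCoordinates_transition (hx : x ∈ (φ c).target)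
    (hx' : (φ c).symm x ∈ (φ c').source) :
    IsChangeOfCoordinates (φ c' ∘ (φ c).symm) (φ c ∘ (φ c').symm) x where
  contDiffAt := (contDiffAt_transition hx hx').of_le (by norm_cast)
  contDiffAt_symm := (contDiffAt_transition ((φ c').map_source hx')
    (mem_source_transition hx hx')).of_le (by norm_cast)
  right_inv := eventually_transition_transition ((φ c').map_source hx')
    (mem_source_transition hx hx')
  left_inv := eventually_transition_transition hx hx'

theorem fderiv_transition_symm (hx : x ∈ (φ c).target) (hx' : (φ c).symm x ∈ (φ c').source) :
    fderiv ℝ (φ c ∘ (φ c').symm) ((φ c' ∘ (φ c).symm) x) =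
      (chartDeriv c ((φ c).symm x)).comp (chartSymmDeriv c' ((φ c' ∘ (φ c).symm) x)) := by
  have hderiv := (hasFDerivAt_transition (x := (φ c' ∘ (φ c).symm) x) ((φ c').map_source hx')
    (mem_source_transition hx hx')).fderiv
  rwa [extChartAt_symm_transition hx'] at hderiv

end Transition

namespace ContactSubRiemannian

variable {n : ℕ} {M : Type*} [TopologicalSpace M] [ChartedSpace (ContactModel n) M]
  [IsManifold (𝓡 (2 * n + 1)) ∞ M]

local notation "φ" => extChartAt (𝓡 (2 * n + 1))

theorem hamiltonianInChart_transition (S : ContactSubRiemannian n M) {c c' : M}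
    {y : ContactModel n} (hy : y ∈ (φ c).target) (hy' : (φ c).symm y ∈ (φ c').source)
    (η : ContactModel n →L[ℝ] ℝ) :
    S.hamiltonianInChart c y η = S.hamiltonianInChart c' ((φ c' ∘ (φ c).symm) y)
      (η.comp (fderiv ℝ (φ c ∘ (φ c').symm) ((φ c' ∘ (φ c).symm) y))) := by
  let H (q : M) (ξ : ContactModel n →L[ℝ] ℝ) : ℝ := S.hamiltonian q ξ
  have hcomp := chartSymmDeriv_comp_chartDeriv (x := (φ c' ∘ (φ c).symm) y)
    ((φ c').map_source hy')
  rw [extChartAt_symm_transition hy'] at hcomp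
  have hcovector : (η.comp ((chartDeriv c ((φ c).symm y)).comp
      (chartSymmDeriv c' ((φ c' ∘ (φ c).symm) y)))).comp (chartDeriv c' ((φ c).symm y)) =
      η.comp (chartDeriv c ((φ c).symm y)) := by
    rw [ContinuousLinearMap.comp_assoc, ContinuousLinearMap.comp_assoc, hcomp,
      ContinuousLinearMap.comp_id]
  rw [fderiv_transition_symm hy hy']
  change H ((φ c).symm y) (η.comp (chartDeriv c ((φ c).symm y))) =
    H ((φ c').symm ((φ c' ∘ (φ c).symm) y)) ((η.comp ((chartDeriv c ((φ c).symm y)).comp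
      (chartSymmDeriv c' _))).comp (chartDeriv c' ((φ c').symm _)))
  rw [extChartAt_symm_transition hy', hcovector]

/-- The curve in `T*M` with canonical coordinates `z` in the chart around `c`. -/
noncomputable def liftCurve (c : M) (z : ℝ → ContactModel n × (ContactModel n →L[ℝ] ℝ))
    (s : ℝ) : CotBundle n M :=
  ⟨(φ c).symm (z s).1, covectorOfChart c (z s).1 (z s).2⟩

theorem covectorInChart_liftCurve {c c' : M}
    {z : ℝ → ContactModel n × (ContactModel n →L[ℝ] ℝ)} {s : ℝ} (hs : (z s).1 ∈ (φ c).target)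
    (hs' : (φ c).symm (z s).1 ∈ (φ c').source) :
    covectorInChart c' (liftCurve c z s).proj (liftCurve c z s).snd =
      (z s).2.comp (fderiv ℝ (φ c ∘ (φ c').symm) ((φ c' ∘ (φ c).symm) (z s).1)) := by
  rw [fderiv_transition_symm hs hs']
  rfl

theorem IsCometricInChart.isNormalExtremal_liftCurve {S : ContactSubRiemannian n M} {q₀ : M}
    {B : ContactModel n → (ContactModel n →L[ℝ] ℝ) →L[ℝ] ContactModel n}
    {θ : ContactModel n → ContactModel n →L[ℝ] ℝ} {Ω : Set (ContactModel n)}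
    (h : S.IsCometricInChart q₀ B θ Ω) {T : ℝ}
    {z : ℝ → ContactModel n × (ContactModel n →L[ℝ] ℝ)}
    (hz : ∀ s ∈ Icc 0 T, (z s).1 ∈ Ω ∧ HasDerivAt z (cometricField B (z s)) s) :
    S.IsNormalExtremal T (liftCurve q₀ z) := by
  have hcont : ∀ s ∈ Icc 0 T, ContinuousAt (fun s => (z s).1) s := fun s hs =>
    (hz s hs).2.continuousAt.fst
  refine ⟨fun s hs => ((continuousAt_extChartAt_symm'' (h.subset_target (hz s hs).1)).comp
    (f := fun s => (z s).1) (hcont s hs)).continuousWithinAt, fun c t ht hsrc => ?_⟩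
  have htarget : (z t).1 ∈ (φ q₀).target := h.subset_target (hz t ht).1
  have hψ := isChangeOfCoordinates_transition htarget hsrc
  have hz₁ : HasDerivWithinAt (fun s => (z s).1) (cometricField B (z t)).1 (Icc 0 T) t :=
    (hz t ht).2.hasDerivWithinAt.fst
  have hz₂ : HasDerivWithinAt (fun s => (z s).2) (cometricField B (z t)).2 (Icc 0 T) t :=
    (hz t ht).2.hasDerivWithinAt.snd
  have hx := hψ.hasDerivWithinAt_position hz₁
  have hξ := (hψ.hasDerivWithinAt_momentum hz₁ hz₂).congr_of_eventuallyEq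
    (f₁ := fun s => covectorInChart c (liftCurve q₀ z s).proj (liftCurve q₀ z s).snd) (by
    filter_upwards [((hcont t ht).eventually
      (eventually_mem_transition htarget hsrc)).filter_mono nhdsWithin_le_nhds] with s hs
    exact covectorInChart_liftCurve hs.1 hs.2) (covectorInChart_liftCurve htarget hsrc)
  have hH₁ := hψ.hasFDerivAt_hamiltonian (H₁ := S.hamiltonianInChart c)
    ((eventually_mem_transition ((φ c).map_source hsrc) (mem_source_transition htarget hsrc)).mono
      fun y hy η => S.hamiltonianInChart_transition hy.1 hy.2 η)
    (h.hasFDerivAt_hamiltonian h.hamiltonianInChart_eq (hz t ht).1)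
  rw [← covectorInChart_liftCurve htarget hsrc] at hH₁
  refine ⟨fun a => ?_, fun u => ?_⟩
  · exact (a.hasFDerivAt.comp_hasDerivWithinAt t hx).congr_deriv
      (fderiv_momentum_of_hasFDerivAt_symplecticDual hH₁ a).symm
  · refine ((ContinuousLinearMap.apply ℝ ℝ u).hasFDerivAt.comp_hasDerivWithinAt t hξ).congr_deriv ?_
    exact ((congrArg Neg.neg (fderiv_position_of_hasFDerivAt_symplecticDual hH₁ u)).trans
      (neg_neg _)).symm

end ContactSubRiemannian

section WeakDerivative

variable {E : Type*} [NormedAddCommGroup E] [NormedSpace ℝ E] [FiniteDimensional ℝ E] {I : Set ℝ}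
  {t : ℝ}

theorem hasDerivWithinAt_of_forall_dual {f : ℝ → E} {f' : E}
    (h : ∀ a : E →L[ℝ] ℝ, HasDerivWithinAt (fun s => a (f s)) (a f') I t) :
    HasDerivWithinAt f f' I t := by
  let b := Module.finBasis ℝ E
  have hsum : HasDerivWithinAt (fun s => ∑ i, (b.coord i).toContinuousLinearMap (f s) • b i)
      (∑ i, (b.coord i).toContinuousLinearMap f' • b i) I t :=
    HasDerivWithinAt.fun_sum fun i _ => (h _).smul_const (b i)
  have hrepr : ∀ v, ∑ i, (b.coord i).toContinuousLinearMap v • b i = v := fun v => b.sum_repr v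
  simpa only [hrepr] using hsum

theorem hasDerivWithinAt_dual_of_forall {ξ : ℝ → E →L[ℝ] ℝ} {α : E →L[ℝ] ℝ}
    (h : ∀ u : E, HasDerivWithinAt (fun s => ξ s u) (α u) I t) : HasDerivWithinAt ξ α I t := by
  let b := Module.finBasis ℝ E
  have hsum : HasDerivWithinAt (fun s => ∑ i, ξ s (b i) • (b.coord i).toContinuousLinearMap)
      (∑ i, α (b i) • (b.coord i).toContinuousLinearMap) I t :=
    HasDerivWithinAt.fun_sum fun i _ => (h _).smul_const _
  have hrepr : ∀ η : E →L[ℝ] ℝ, ∑ i, η (b i) • (b.coord i).toContinuousLinearMap = η := fun η => by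
    ext v
    conv_rhs => rw [← b.sum_repr v, map_sum]
    simp [mul_comm]
  simpa only [hrepr] using hsum

end WeakDerivative

theorem eventuallyEq_nhdsGE_of_hasDerivWithinAt {E : Type*} [NormedAddCommGroup E]
    [NormedSpace ℝ E] {F : E → E} {y z : ℝ → E} {s : ℝ} (hF : ContDiffAt ℝ 1 F (z s))
    (hy : ∀ᶠ r in 𝓝[≥] s, HasDerivWithinAt y (F (y r)) (Ici s) r)
    (hz : ∀ᶠ r in 𝓝[≥] s, HasDerivWithinAt z (F (z r)) (Ici s) r) (hyz : y s = z s) :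
    y =ᶠ[𝓝[≥] s] z := by
  obtain ⟨K, N, hN, hK⟩ := hF.exists_lipschitzOnWith
  have hs : s ∈ Ici s := self_mem_Ici
  have hyN : ∀ᶠ r in 𝓝[≥] s, y r ∈ N :=
    (hy.self_of_nhdsWithin hs).continuousWithinAt.eventually_mem (hyz ▸ hN)
  have hzN : ∀ᶠ r in 𝓝[≥] s, z r ∈ N :=
    (hz.self_of_nhdsWithin hs).continuousWithinAt.eventually_mem hN
  obtain ⟨u, hsu, hu⟩ := mem_nhdsGE_iff_exists_Icc_subset.1 ((hy.and hyN).and (hz.and hzN))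
  have hright : ∀ {x : ℝ → E} {x' : E} {r : ℝ}, r ∈ Ico s u →
      HasDerivWithinAt x x' (Ici s) r → HasDerivWithinAt x x' (Ici r) r :=
    fun hr hx => hx.mono (Ici_subset_Ici.2 hr.1)
  have heq : EqOn y z (Icc s u) := ODE_solution_unique_of_mem_Icc_right (v := fun _ => F)
    (s := fun _ => N) (fun _ _ => hK)
    (fun r hr => (hu hr).1.1.continuousWithinAt.mono Icc_subset_Ici_self)
    (fun r hr => hright hr (hu (Ico_subset_Icc_self hr)).1.1)
    (fun r hr => (hu (Ico_subset_Icc_self hr)).1.2)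
    (fun r hr => (hu hr).2.1.continuousWithinAt.mono Icc_subset_Ici_self)
    (fun r hr => hright hr (hu (Ico_subset_Icc_self hr)).2.1)
    (fun r hr => (hu (Ico_subset_Icc_self hr)).2.2) hyz
  exact Filter.mem_of_superset (Icc_mem_nhdsGE hsu) heq

namespace ContactSubRiemannian

variable {n : ℕ} {M : Type*} [TopologicalSpace M] [ChartedSpace (ContactModel n) M]

local notation "φ" => extChartAt (𝓡 (2 * n + 1))

/-- The canonical coordinates of a point of `T*M` in the chart around `c`. -/
noncomputable def coordInChart (c : M) (w : CotBundle n M) :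
    ContactModel n × (ContactModel n →L[ℝ] ℝ) :=
  (φ c w.proj, covectorInChart c w.proj w.snd)

/-- The times at which the curve `w` in `T*M` has the canonical coordinates `z` in the chart
around `c`. -/
def agreementSet (c : M) (w : ℝ → CotBundle n M)
    (z : ℝ → ContactModel n × (ContactModel n →L[ℝ] ℝ)) : Set ℝ :=
  {s | (w s).proj ∈ (φ c).source ∧ coordInChart c (w s) = z s}

theorem proj_eq_of_mem_agreementSet {c : M} {w : ℝ → CotBundle n M}
    {z : ℝ → ContactModel n × (ContactModel n →L[ℝ] ℝ)} {s : ℝ} (hs : s ∈ agreementSet c w z) :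
    (w s).proj = (φ c).symm (z s).1 := by
  rw [← hs.2]
  exact ((φ c).left_inv hs.1).symm

namespace IsNormalExtremal

variable [IsManifold (𝓡 (2 * n + 1)) ∞ M] {S : ContactSubRiemannian n M} {q₀ : M}
  {B : ContactModel n → (ContactModel n →L[ℝ] ℝ) →L[ℝ] ContactModel n}
  {θ : ContactModel n → ContactModel n →L[ℝ] ℝ} {Ω : Set (ContactModel n)} {T : ℝ}
  {w : ℝ → CotBundle n M} {z : ℝ → ContactModel n × (ContactModel n →L[ℝ] ℝ)} {t : ℝ}

theorem hasDerivWithinAt_coordInChart (hw : S.IsNormalExtremal T w)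
    (h : S.IsCometricInChart q₀ B θ Ω) (ht : t ∈ Icc 0 T) (hsrc : (w t).proj ∈ (φ q₀).source)
    (htΩ : φ q₀ (w t).proj ∈ Ω) :
    HasDerivWithinAt (fun s => coordInChart q₀ (w s))
      (cometricField B (coordInChart q₀ (w t))) (Icc 0 T) t := by
  have hH := h.hasFDerivAt_hamiltonian h.hamiltonianInChart_eq (z := coordInChart q₀ (w t)) htΩ
  obtain ⟨hposition, hmomentum⟩ := hw.2 q₀ t ht hsrc
  refine HasDerivWithinAt.prodMk (hasDerivWithinAt_of_forall_dual fun a => ?_)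
    (hasDerivWithinAt_dual_of_forall fun u => ?_)
  · exact (hposition a).congr_deriv (fderiv_momentum_of_hasFDerivAt_symplecticDual hH a)
  · exact (hmomentum u).congr_deriv <| (congrArg Neg.neg
      (fderiv_position_of_hasFDerivAt_symplecticDual hH u)).trans (neg_neg _)

theorem isClosed_agreementSet [T2Space M] (hw : S.IsNormalExtremal T w)
    (h : S.IsCometricInChart q₀ B θ Ω)
    (hz : ∀ s ∈ Icc 0 T, (z s).1 ∈ Ω ∧ HasDerivAt z (cometricField B (z s)) s) :
    IsClosed (agreementSet q₀ w z ∩ Icc 0 T) := by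
  refine isClosed_of_closure_subset fun s hs => ?_
  have hsI : s ∈ Icc 0 T := closure_minimal inter_subset_right isClosed_Icc hs
  obtain ⟨hzΩ, hzd⟩ := hz s hsI
  have hne : (𝓝[agreementSet q₀ w z ∩ Icc 0 T] s).NeBot := mem_closure_iff_nhdsWithin_neBot.1 hs
  have hle : 𝓝[agreementSet q₀ w z ∩ Icc 0 T] s ≤ 𝓝[Icc 0 T] s :=
    nhdsWithin_mono _ inter_subset_right
  have hproj : (w s).proj = (φ q₀).symm (z s).1 := by
    refine tendsto_nhds_unique_of_eventuallyEq ((hw.1 s hsI).mono_left hle)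
      (((continuousAt_extChartAt_symm'' (h.subset_target hzΩ)).comp (f := fun s => (z s).1)
        hzd.continuousAt.fst).tendsto.mono_left nhdsWithin_le_nhds) ?_
    filter_upwards [self_mem_nhdsWithin] with r hr using proj_eq_of_mem_agreementSet hr.1
  have hsrc : (w s).proj ∈ (φ q₀).source := hproj ▸ (φ q₀).map_target (h.subset_target hzΩ)
  have hφ : φ q₀ (w s).proj = (z s).1 := by rw [hproj, (φ q₀).right_inv (h.subset_target hzΩ)]
  have hd := hw.hasDerivWithinAt_coordInChart h hsI hsrc (hφ ▸ hzΩ)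
  refine ⟨⟨hsrc, tendsto_nhds_unique_of_eventuallyEq (hd.continuousWithinAt.mono_left hle)
    (hzd.continuousAt.tendsto.mono_left nhdsWithin_le_nhds) ?_⟩, hsI⟩
  filter_upwards [self_mem_nhdsWithin] with r hr using hr.1.2

theorem eventually_mem_agreementSet (hw : S.IsNormalExtremal T w)
    (h : S.IsCometricInChart q₀ B θ Ω)
    (hz : ∀ s ∈ Icc 0 T, (z s).1 ∈ Ω ∧ HasDerivAt z (cometricField B (z s)) s)
    (ht : t ∈ agreementSet q₀ w z) (htT : t ∈ Ico 0 T) :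
    ∀ᶠ r in 𝓝[≥] t, r ∈ agreementSet q₀ w z := by
  have htI : t ∈ Icc 0 T := Ico_subset_Icc_self htT
  have hI : Ico t T ∈ 𝓝[≥] t := Ico_mem_nhdsGE htT.2
  have hle : 𝓝[≥] t ≤ 𝓝[Icc 0 T] t := nhdsWithin_le_of_mem <|
    Filter.mem_of_superset hI (Ico_subset_Icc_self.trans (Icc_subset_Icc_left htT.1))
  have htΩ : φ q₀ (w t).proj ∈ Ω := by
    rw [show φ q₀ (w t).proj = (z t).1 from congrArg Prod.fst ht.2]
    exact (hz t htI).1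
  have hsrc : ∀ᶠ r in 𝓝[≥] t, (w r).proj ∈ (φ q₀).source :=
    ((hw.1 t htI).mono_left hle).eventually_mem ((isOpen_extChartAt_source q₀).mem_nhds ht.1)
  have hΩ : ∀ᶠ r in 𝓝[≥] t, φ q₀ (w r).proj ∈ Ω :=
    hle <| (hw.hasDerivWithinAt_coordInChart h htI ht.1 htΩ).continuousWithinAt.fst.eventually_mem
      (h.isOpen.mem_nhds htΩ)
  have hcoord : ∀ᶠ r in 𝓝[≥] t, coordInChart q₀ (w r) = z r := by
    refine eventuallyEq_nhdsGE_of_hasDerivWithinAt (F := cometricField B)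
      ((contDiffAt_cometricField (h.contDiffAt (hz t htI).1)).of_le (by norm_cast)) ?_ ?_ ht.2
    · filter_upwards [hsrc, hΩ, hI] with r hr hrΩ hrI
      refine (hw.hasDerivWithinAt_coordInChart h ⟨htT.1.trans hrI.1, hrI.2.le⟩ hr
        hrΩ).mono_of_mem_nhdsWithin ?_
      filter_upwards [self_mem_nhdsWithin, mem_nhdsWithin_of_mem_nhds (Iic_mem_nhds hrI.2)]
        with u hu huT using ⟨htT.1.trans hu, huT⟩
    · filter_upwards [hI] with r hr
      exact (hz r ⟨htT.1.trans hr.1, hr.2.le⟩).2.hasDerivWithinAt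
  filter_upwards [hsrc, hcoord] with r hr hr' using ⟨hr, hr'⟩

theorem proj_eq [T2Space M] (hw : S.IsNormalExtremal T w) (h : S.IsCometricInChart q₀ B θ Ω)
    (hz : ∀ s ∈ Icc 0 T, (z s).1 ∈ Ω ∧ HasDerivAt z (cometricField B (z s)) s)
    {p : CotSpace n q₀} (hw₀ : w 0 = ⟨q₀, p⟩)
    (hz₀ : z 0 = (φ q₀ q₀, covectorInChart q₀ q₀ p)) (ht : t ∈ Icc 0 T) :
    (w t).proj = (φ q₀).symm (z t).1 := by
  have h₀ : 0 ∈ agreementSet q₀ w z := by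
    rw [agreementSet, mem_ofPred_eq, hw₀, hz₀]
    exact ⟨mem_extChartAt_source q₀, rfl⟩
  exact proj_eq_of_mem_agreementSet <|
    (hw.isClosed_agreementSet h hz).Icc_subset_of_forall_mem_nhdsWithin
      h₀ (fun _ hs => (hw.eventually_mem_agreementSet h hz hs.1 hs.2).filter_mono
        (nhdsWithin_mono _ Ioi_subset_Ici_self)) ht

end IsNormalExtremal

end ContactSubRiemannian

theorem fderiv_smul_of_homogeneous {F : Type*} [NormedAddCommGroup F] [NormedSpace ℝ F]
    {f : F → ℝ} {c : ℝ} (hc : c ≠ 0) (hf : ∀ x, f (c • x) = c ^ 2 * f x) (x : F) :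
    fderiv ℝ f (c • x) = c • fderiv ℝ f x := by
  have hchain : c • fderiv ℝ f (c • x) = c ^ 2 • fderiv ℝ f x := by
    rw [← fderiv_comp_smul, show (fun y => f (c • y)) = c ^ 2 • f from funext hf,
      fderiv_const_smul_field, Pi.smul_apply]
  rw [sq, mul_smul] at hchain
  exact smul_right_injective _ hc hchain

theorem isCompact_setOf_apply_eq_one {E : Type*} [NormedAddCommGroup E] [NormedSpace ℝ E]
    [FiniteDimensional ℝ E] {P : (E →L[ℝ] ℝ) →L[ℝ] E} (hsymm : ∀ η ζ : E →L[ℝ] ℝ, η (P ζ) = ζ (P η))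
    (hnonneg : ∀ η : E →L[ℝ] ℝ, 0 ≤ η (P η)) {v : E}
    (hv : ∀ η : E →L[ℝ] ℝ, P η = 0 → η v = 0 → η = 0) (b : ℝ) :
    IsCompact {η : E →L[ℝ] ℝ | η (P η) = 1 ∧ |η v| ≤ b} := by
  let L : (E →L[ℝ] ℝ) →ₗ[ℝ] E × ℝ :=
    P.toLinearMap.prod (ContinuousLinearMap.apply ℝ ℝ v).toLinearMap
  have hL : L.ker = ⊥ := LinearMap.ker_eq_bot'.2 fun η hη =>
    hv η (congrArg Prod.fst hη) (congrArg Prod.snd hη)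
  obtain ⟨K, -, hK⟩ := L.exists_antilipschitzWith hL
  refine Metric.isCompact_of_isClosed_isBounded ?_ ((hK.isBounded_preimage
    (Metric.isBounded_closedBall (x := 0) (r := max √‖P‖ b))).subset fun η hη => ?_)
  · exact (isClosed_eq (continuous_id.clm_apply P.continuous) continuous_const).inter
      (isClosed_le (ContinuousLinearMap.apply ℝ ℝ v).continuous.abs continuous_const)
  · have hPη := norm_sq_apply_le_of_symm_nonneg hsymm hnonneg le_rfl η
    rw [hη.1, mul_one] at hPη
    rw [mem_preimage, mem_closedBall_zero_iff]
    exact max_le_max (Real.le_sqrt_of_sq_le hPη) hη.2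

namespace ContactSubRiemannian

variable {n : ℕ} {M : Type*} [TopologicalSpace M] [ChartedSpace (ContactModel n) M]
  [IsManifold (𝓡 (2 * n + 1)) ∞ M]

local notation "φ" => extChartAt (𝓡 (2 * n + 1))

theorem hamiltonian_smul (S : ContactSubRiemannian n M) (q : M) (c : ℝ) (p : CotSpace n q) :
    S.hamiltonian q (c • p) = c ^ 2 * S.hamiltonian q p := by
  unfold hamiltonian
  rw [mul_left_comm, Real.mul_iSup_of_nonneg (sq_nonneg c)]
  congr 2
  funext v
  change (c * p (v : S.Δ q)) ^ 2 / _ = _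
  ring

theorem hamiltonianInChart_smul (S : ContactSubRiemannian n M) (q : M) (x : ContactModel n) (c : ℝ)
    (ξ : ContactModel n →L[ℝ] ℝ) :
    S.hamiltonianInChart q x (c • ξ) = c ^ 2 * S.hamiltonianInChart q x ξ :=
  S.hamiltonian_smul _ c (covectorOfChart q x ξ)

theorem IsNormalExtremal.rescale {S : ContactSubRiemannian n M} {T : ℝ} {w : ℝ → CotBundle n M}
    (hw : S.IsNormalExtremal T w) {c T' : ℝ} (hc : 0 < c) (hT : c * T' = T) :
    S.IsNormalExtremal T' (fun s => ⟨(w (c * s)).proj, c • (w (c * s)).snd⟩) := by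
  have hmaps : MapsTo (fun s => c * s) (Icc 0 T') (Icc 0 T) := fun s hs =>
    ⟨mul_nonneg hc.le hs.1, hT ▸ mul_le_mul_of_nonneg_left hs.2 hc.le⟩
  refine ⟨hw.1.comp (by fun_prop) hmaps, fun q t ht hsrc => ?_⟩
  obtain ⟨hposition, hmomentum⟩ := hw.2 q (c * t) (hmaps ht) hsrc
  have hmul : HasDerivWithinAt (fun s : ℝ => c * s) c (Icc 0 T') t := by
    simpa using ((hasDerivAt_id t).const_mul c).hasDerivWithinAt
  set x := φ q (w (c * t)).proj
  set ξ := covectorInChart q (w (c * t)).proj (w (c * t)).snd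
  refine ⟨fun a => ?_, fun u => ?_⟩
  · refine (HasDerivWithinAt.scomp t (hposition a) hmul hmaps).congr_deriv ?_
    exact (DFunLike.congr_fun
      (fderiv_smul_of_homogeneous hc.ne' (S.hamiltonianInChart_smul q x c) ξ) a).symm
  · refine ((HasDerivWithinAt.scomp t (hmomentum u) hmul hmaps).const_mul c).congr_deriv ?_
    have hfderiv : fderiv ℝ (fun y => S.hamiltonianInChart q y (c • ξ)) x =
        c ^ 2 • fderiv ℝ (fun y => S.hamiltonianInChart q y ξ) x := by
      rw [show (fun y => S.hamiltonianInChart q y (c • ξ)) =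
          c ^ 2 • fun y => S.hamiltonianInChart q y ξ from
        funext fun y => S.hamiltonianInChart_smul q y c ξ, fderiv_const_smul_field, Pi.smul_apply]
    refine Eq.trans ?_ (congrArg (fun L => -L u) hfderiv).symm
    simp only [smul_apply, smul_eq_mul]
    ring

theorem mk_covectorOfChart_covectorInChart {c q : M} (hq : q ∈ (φ c).source) (p : CotSpace n q) :
    (⟨(φ c).symm (φ c q), covectorOfChart c (φ c q) (covectorInChart c q p)⟩ : CotBundle n M) =
      ⟨q, p⟩ := by
  have hcovector : (covectorOfChart c (φ c q) (covectorInChart c q p) : ContactModel n →L[ℝ] ℝ) =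
      p := by
    ext v
    exact congrArg p (DFunLike.congr_fun (chartSymmDeriv_comp_chartDeriv ((φ c).map_source hq)) v)
  have hmk : ∀ q' : M, q' = q → ∀ ξ : ContactModel n →L[ℝ] ℝ,
      ξ = p → (⟨q', ξ⟩ : CotBundle n M) = ⟨q, p⟩ := by
    rintro q' rfl ξ rfl
    rfl
  exact hmk _ ((φ c).left_inv hq) _ hcovector

theorem hamiltonian_eq_hamiltonianInChart (S : ContactSubRiemannian n M) {c q : M}
    (hq : q ∈ (φ c).source) (p : CotSpace n q) :
    S.hamiltonian q p = S.hamiltonianInChart c (φ c q) (covectorInChart c q p) :=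
  congrArg (fun w : CotBundle n M => S.hamiltonian w.proj w.snd)
    (mk_covectorOfChart_covectorInChart hq p).symm

theorem surjective_mfderiv_of_chart {V : Type*} [NormedAddCommGroup V] [NormedSpace ℝ V] {c : M}
    {F : V → M} {G : V → ContactModel n} {D : V →L[ℝ] ContactModel n} {p : V}
    (hFG : F =ᶠ[𝓝 p] fun p' => (φ c).symm (G p')) (hG : HasFDerivAt G D p)
    (hp : G p ∈ (φ c).target) (hD : Function.Surjective D) :
    Function.Surjective (mfderiv 𝓘(ℝ, V) (𝓡 (2 * n + 1)) F p) := by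
  rw [(((mdifferentiableAt_extChartAt_symm_of_mem_target hp).hasMFDerivAt.comp p
    hG.hasMFDerivAt).congr_of_eventuallyEq hFG).mfderiv]
  have hsymm : Function.Surjective (chartSymmDeriv c (G p)) := fun v =>
    ⟨chartDeriv c ((φ c).symm (G p)) v, DFunLike.congr_fun (chartSymmDeriv_comp_chartDeriv hp) v⟩
  exact hsymm.comp hD

theorem exp_eq_of_forall (S : ContactSubRiemannian n M) {q x : M} {t : ℝ} {p : CotSpace n q}
    (hp : p ∈ S.expDomain q t)
    (h : ∀ w : ℝ → CotBundle n M, w 0 = ⟨q, p⟩ → S.IsNormalExtremal t w → (w t).proj = x) :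
    S.exp q t p = x := by
  unfold exp
  rw [dif_pos hp]
  exact h _ hp.choose_spec.1 hp.choose_spec.2

theorem chartSymmDeriv_chartDeriv_self (c : M) (v : ContactModel n) :
    chartSymmDeriv c (φ c c) (chartDeriv c c v) = v := by
  have hcomp := chartSymmDeriv_comp_chartDeriv (mem_extChartAt_target (I := 𝓡 (2 * n + 1)) c)
  rw [extChartAt_to_inv] at hcomp
  exact DFunLike.congr_fun hcomp v

theorem chartDeriv_chartSymmDeriv_self (c : M) (v : ContactModel n) :
    chartDeriv c c (chartSymmDeriv c (φ c c) v) = v := by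
  have hcomp := chartDeriv_comp_chartSymmDeriv (mem_extChartAt_target (I := 𝓡 (2 * n + 1)) c)
  rw [extChartAt_to_inv] at hcomp
  exact DFunLike.congr_fun hcomp v

/-- The isomorphism taking a covector at `c` to its momentum coordinates in the chart around `c`;
both are stored as linear forms on the model space. -/
noncomputable def momentumAt (c : M) :
    (ContactModel n →L[ℝ] ℝ) ≃L[ℝ] (ContactModel n →L[ℝ] ℝ) :=
  ContinuousLinearEquiv.arrowCongr
    (.equivOfInverse (chartDeriv c c) (chartSymmDeriv c (φ c c))
      (fun v => chartSymmDeriv_chartDeriv_self c v)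
      (fun v => chartDeriv_chartSymmDeriv_self c v))
    (.refl ℝ ℝ)

theorem momentumAt_apply_chartDeriv (c : M) (p : ContactModel n →L[ℝ] ℝ) (v : ContactModel n) :
    momentumAt c p (chartDeriv c c v) = p v :=
  congrArg p (chartSymmDeriv_chartDeriv_self c v)

namespace IsCometricInChart

variable {S : ContactSubRiemannian n M} {q₀ : M}
  {B : ContactModel n → (ContactModel n →L[ℝ] ℝ) →L[ℝ] ContactModel n}
  {θ : ContactModel n → ContactModel n →L[ℝ] ℝ} {Ω : Set (ContactModel n)}

theorem hamiltonian_eq (h : S.IsCometricInChart q₀ B θ Ω) (p : ContactModel n →L[ℝ] ℝ) :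
    S.hamiltonian q₀ p = 1 / 2 * momentumAt q₀ p (B (φ q₀ q₀) (momentumAt q₀ p)) :=
  (S.hamiltonian_eq_hamiltonianInChart (mem_extChartAt_source q₀) p).trans
    (h.hamiltonianInChart_eq _ h.mem _)

theorem exp_eq_extChartAt_symm [T2Space M] (h : S.IsCometricInChart q₀ B θ Ω)
    {p : CotSpace n q₀} {c t : ℝ} (hc : 0 < c) (ht : 0 ≤ t)
    {z : ℝ → ContactModel n × (ContactModel n →L[ℝ] ℝ)}
    (hz₀ : z 0 = (φ q₀ q₀, covectorInChart q₀ q₀ (c⁻¹ • p)))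
    (hz : ∀ s ∈ Icc 0 (c * t), (z s).1 ∈ Ω ∧ HasDerivAt z (cometricField B (z s)) s) :
    S.exp q₀ t p = (φ q₀).symm (z (c * t)).1 := by
  refine S.exp_eq_of_forall
    ⟨_, ?_, (h.isNormalExtremal_liftCurve hz).rescale hc rfl⟩ fun w hw₀ hw => ?_
  · have hlift₀ : liftCurve q₀ z 0 = ⟨q₀, c⁻¹ • p⟩ := by
      unfold liftCurve
      rw [hz₀]
      exact mk_covectorOfChart_covectorInChart (mem_extChartAt_source q₀) (c⁻¹ • p)
    rw [mul_zero, hlift₀]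
    exact congrArg (Bundle.TotalSpace.mk q₀) (smul_inv_smul₀ hc.ne' p)
  · have hproj := (hw.rescale (inv_pos.2 hc) (inv_mul_cancel_left₀ hc.ne' t)).proj_eq
      (p := c⁻¹ • p) h hz (by rw [mul_zero, hw₀]) hz₀ (right_mem_Icc.2 (by positivity))
    rwa [inv_mul_cancel_left₀ hc.ne'] at hproj

theorem isCompact_setOf_hamiltonian_eq (h : S.IsCometricInChart q₀ B θ Ω) {X : ContactModel n}
    (hX : X ∉ S.Δ q₀) (b : ℝ) :
    IsCompact {p : ContactModel n →L[ℝ] ℝ | S.hamiltonian q₀ p = 1 / 2 ∧ |p X| ≤ b} := by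
  have hθX : θ (φ q₀ q₀) (chartDeriv q₀ q₀ X) ≠ 0 := fun h₀ => hX ((h.mem_distribution_iff X).2 h₀)
  have hker : ∀ η : ContactModel n →L[ℝ] ℝ,
      B (φ q₀ q₀) η = 0 → η (chartDeriv q₀ q₀ X) = 0 → η = 0 := by
    intro η hη hηX
    obtain ⟨f, rfl⟩ := (h.apply_eq_zero_iff _ h.mem η).1 hη
    rw [(mul_eq_zero.1 hηX).resolve_right hθX, zero_smul]
  convert (momentumAt (n := n) q₀).toHomeomorph.isCompact_preimage.2
    (isCompact_setOf_apply_eq_one (h.symm _ h.mem) (h.nonneg _ h.mem) hker b) using 1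
  ext p
  refine and_congr ?_ ?_
  · rw [h.hamiltonian_eq]
    exact mul_eq_left₀ (by norm_num)
  · exact Iff.of_eq (congrArg (|·| ≤ b) (momentumAt_apply_chartDeriv q₀ p X).symm)

/- `E(t, p) = E(c t, p / c)`: a small time suffices once `p / c` is near `p₀`, whatever `p` is. -/
theorem eventually_not_isCriticalPoint [T2Space M] (h : S.IsCometricInChart q₀ B θ Ω)
    {p₀ : ContactModel n →L[ℝ] ℝ} (hp₀ : S.hamiltonian q₀ p₀ ≠ 0) :
    ∀ᶠ x : ℝ × (ContactModel n →L[ℝ] ℝ) in 𝓝[>] 0 ×ˢ 𝓝 p₀, ∀ (c t : ℝ)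
      (p : ContactModel n →L[ℝ] ℝ), 0 < c → (c * t, c⁻¹ • p) = x → ¬ S.IsCriticalPoint q₀ t p := by
  have hB : B (φ q₀ q₀) (momentumAt q₀ p₀) ≠ 0 := fun h₀ => hp₀ <| by
    rw [h.hamiltonian_eq, h₀, map_zero, mul_zero]
  obtain ⟨r, hr, ε, hε, Z, hZ⟩ := h.exists_flow hB
  have hball : momentumAt (n := n) q₀ ⁻¹' Metric.ball (momentumAt q₀ p₀) r ∈ 𝓝 p₀ :=
    (momentumAt q₀).continuous.continuousAt (Metric.ball_mem_nhds _ hr)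
  filter_upwards [Filter.prod_mem_prod (Ioo_mem_nhdsGT hε) hball]
  rintro _ ⟨ht, hp⟩ c t p hc rfl hcrit
  let L : (ContactModel n →L[ℝ] ℝ) →L[ℝ] (ContactModel n →L[ℝ] ℝ) :=
    (momentumAt (n := n) q₀).toContinuousLinearMap.comp (c⁻¹ • .id ℝ _)
  have hL : Function.Surjective L := (momentumAt (n := n) q₀).surjective.comp fun η =>
    ⟨c • η, inv_smul_smul₀ hc.ne' η⟩
  obtain ⟨-, hZt⟩ := hZ _ hp
  obtain ⟨hΩ, -, D, hD, hDs⟩ := hZt _ (Ioo_subset_Ico_self ht)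
  have hexp : (fun p' => S.exp q₀ t p') =ᶠ[𝓝 p] fun p' => (φ q₀).symm (Z (L p') (c * t)).1 := by
    have hmem : ∀ᶠ p' in 𝓝 p, L p' ∈ Metric.ball (momentumAt q₀ p₀) r :=
      L.continuous.continuousAt.eventually_mem (Metric.isOpen_ball.mem_nhds hp)
    filter_upwards [hmem] with p' hp'
    obtain ⟨hZ₀, hZt⟩ := hZ _ hp'
    exact h.exp_eq_extChartAt_symm hc (pos_of_mul_pos_right ht.1 hc.le).le hZ₀ fun s hs =>
      have hs' := hZt s ⟨hs.1, hs.2.trans_lt ht.2⟩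
      ⟨hs'.1, hs'.2.1⟩
  exact hcrit.2 <| surjective_mfderiv_of_chart hexp
    (HasFDerivAt.comp (g := fun ξ => (Z ξ (c * t)).1) p hD L.hasFDerivAt)
    (h.subset_target hΩ) ((hDs ht.1).comp hL)

end IsCometricInChart

theorem exists_forall_lt_abs_apply [T2Space M] (S : ContactSubRiemannian n M) {q₀ : M}
    {X : ContactModel n} (hX : X ∉ S.Δ q₀) (b : ℝ) :
    ∃ ε > 0, ∀ (t : ℝ) (p : ContactModel n →L[ℝ] ℝ), 0 < t → 0 < S.hamiltonian q₀ p →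
      S.IsCriticalPoint q₀ t p → √(2 * S.hamiltonian q₀ p) * t < ε →
        b * √(2 * S.hamiltonian q₀ p) < |p X| := by
  obtain ⟨B, θ, Ω, h⟩ := S.exists_isCometricInChart q₀
  have hcompact := (h.isCompact_setOf_hamiltonian_eq hX b).mem_prod_nhdsSet_of_forall fun p₀ hp₀ =>
    h.eventually_not_isCriticalPoint (p₀ := p₀) (by rw [hp₀.1]; norm_num)
  obtain ⟨ε, hε, hnot⟩ := mem_nhdsGT_iff_exists_Ioo_subset.1 <|
    Filter.eventually_prod_principal_iff.1 <|
      Filter.prod_mono_right (𝓝[>] (0 : ℝ)) principal_le_nhdsSet hcompact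
  refine ⟨ε, hε, fun t p ht hp hcrit htε => lt_of_not_ge fun hpX => ?_⟩
  set c := √(2 * S.hamiltonian q₀ p)
  have hc : 0 < c := Real.sqrt_pos.2 (by positivity)
  refine hnot ⟨by positivity, htε⟩ (c⁻¹ • p) ⟨?_, ?_⟩ c t p hc rfl hcrit
  · refine (S.hamiltonian_smul q₀ c⁻¹ p).trans ?_
    rw [inv_pow, Real.sq_sqrt (by positivity)]
    field_simp
  · change |c⁻¹ * p X| ≤ b
    rw [abs_mul, abs_of_pos (inv_pos.2 hc)]
    exact (inv_mul_le_iff₀ hc).2 (hpX.trans_eq (mul_comm b c))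

theorem exists_lt_of_firstConjugateTime_lt [T2Space M] (S : ContactSubRiemannian n M) {q₀ : M}
    {X : ContactModel n} (hX : X ∉ S.Δ q₀) (b : ℝ) :
    ∃ ε : ℝ, 0 < ε ∧ ∀ p : ContactModel n →L[ℝ] ℝ, S.hamiltonian q₀ p = 1 / 2 →
      S.firstConjugateTime q₀ p < (ε : EReal) → b < |p X| := by
  obtain ⟨ε, hε, h⟩ := S.exists_forall_lt_abs_apply hX b
  refine ⟨ε, hε, fun p hp hlt => ?_⟩
  obtain ⟨_, ⟨t, ⟨ht, hcrit⟩, rfl⟩, htε⟩ := sInf_lt_iff.1 hlt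
  have hsqrt : √(2 * S.hamiltonian q₀ p) = 1 := by rw [hp]; norm_num
  have hpX := h t p ht (by rw [hp]; norm_num) hcrit
  rw [hsqrt, one_mul, mul_one] at hpX
  exact hpX (EReal.coe_lt_coe_iff.1 htε)

theorem exists_mul_hamiltonian_lt_sq_apply [T2Space M] (S : ContactSubRiemannian n M) {q₀ : M}
    {X : ContactModel n} (hX : X ∉ S.Δ q₀) {α : ℝ} (hα : 0 ≤ α) :
    ∃ R > 0, ∀ p : ContactModel n →L[ℝ] ℝ, 0 < S.hamiltonian q₀ p → S.hamiltonian q₀ p < R →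
      S.IsCriticalPoint q₀ 1 p → α * S.hamiltonian q₀ p < p X ^ 2 := by
  obtain ⟨ε, hε, h⟩ := S.exists_forall_lt_abs_apply hX √(α / 2)
  refine ⟨ε ^ 2 / 2, by positivity, fun p hp hpR hcrit => ?_⟩
  have hpX := h 1 p one_pos hp hcrit (by
    rw [mul_one]
    exact (Real.sqrt_lt' hε).2 (by linarith))
  calc α * S.hamiltonian q₀ p = (√(α / 2) * √(2 * S.hamiltonian q₀ p)) ^ 2 := by
        rw [mul_pow, Real.sq_sqrt (by positivity), Real.sq_sqrt (by positivity)]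
        ring
    _ < |p X| ^ 2 := by gcongr
    _ = p X ^ 2 := sq_abs _

end ContactSubRiemannian

theorem propositionL {n : ℕ} (hn : 1 ≤ n) {M : Type*} [TopologicalSpace M] [T2Space M]
    [ChartedSpace (ContactModel n) M] [IsManifold (𝓡 (2 * n + 1)) ∞ M]
    (S : ContactSubRiemannian n M) (q₀ : M)
    (X₀ : TangentSpace (𝓡 (2 * n + 1)) q₀) (hX₀ : X₀ ∉ S.Δ q₀) :
    (∀ hbar : ℝ, 0 < hbar → ∃ ε : ℝ, 0 < ε ∧ ∀ p : CotSpace n q₀,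
      S.hamiltonian q₀ p = 1 / 2 → S.firstConjugateTime q₀ p < (ε : EReal) → hbar < |p X₀|) ∧
    (∀ α : ℝ, 0 < α → ∃ R : ℝ, 0 < R ∧ ∀ p : CotSpace n q₀,
      0 < S.hamiltonian q₀ p → S.hamiltonian q₀ p < R → S.IsCriticalPoint q₀ 1 p →
        α * S.hamiltonian q₀ p < (p X₀) ^ 2) :=
  ⟨fun hbar _ => S.exists_lt_of_firstConjugateTime_lt hX₀ hbar,
    fun _ hα => S.exists_mul_hamiltonian_lt_sq_apply hX₀ hα.le⟩
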